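/- Let $p$ be a prime number and let $A$ be a complete discrete valuation ring with fraction field $K$, maximal ideal $\mathfrak p_A$, and (possibly imperfect) residue field of characteristic $p$. For an $A$-algebra $B$ write $\overline B=B/\mathfrak p_A B$. Let $\mathrm{CRP}_A$ be the full subcategory of the category of commutative $A$-algebras whose objects are the $A$-algebras $B$ that are flat over $A$, complete (and separated) for the $\mathfrak p_A B$-adic topology, and such that the $\mathbf F_p$-algebra $\overline B$ is perfect, i.e. $x\mapsto x^p$ is bijective on $\overline B$. A \emph{universal residual perfection} $A^{\mathrm u}$ of $A$ is an initial object of $\mathrm{CRP}_A$. A \emph{generic residual perfection} $A^{\mathrm g}$ of $A$ is an object of $\mathrm{CRP}_A$ such that $\overline{A^{\mathrm g}}$, as an algebra over $\overline{A^{\mathrm u}}$ via the reduction of the unique $A$-algebra map $A^{\mathrm u}\to A^{\mathrm g}$, is the fraction field of $\overline{A^{\mathrm u}}$. Then $A^{\mathrm u}$ and $A^{\mathrm g}$ exist, $\overline{A^{\mathrm u}}$ and $A^{\mathrm g}$ are domains, the map $A\to A^{\mathrm g}$ is injective, and $K$ is algebraically closed in the fraction field $K^{\mathrm g}$ of $A^{\mathrm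 g}$: every element of $K^{\mathrm g}$ that is algebraic over $K$ lies in $K$. -/

import Mathlib

universe u v w

namespace ResidualPerfection

/-- The ideal `𝔭_A B` of an `A`-algebra `B` generated by the maximal ideal of the local ring `A`. -/
abbrev maxIdeal (A : Type u) [CommRing A] [IsLocalRing A] (B : Type v) [CommRing B] [Algebra A B] :
    Ideal B :=
  (IsLocalRing.maximalIdeal A).map (algebraMap A B)

/-- The reduction `B / 𝔭_A B` of an `A`-algebra `B`. -/
abbrev Reduction (A : Type u) [CommRing A] [IsLocalRing A] (B : Type v) [CommRing B]
    [Algebra A B] : Type v :=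
  B ⧸ maxIdeal A B

/-- The reduction `B / 𝔭_A B → C / 𝔭_A C` of a map of `A`-algebras `B → C`. -/
def reductionMap {A : Type u} [CommRing A] [IsLocalRing A] {B : Type v} [CommRing B] [Algebra A B]
    {C : Type w} [CommRing C] [Algebra A C] (f : B →ₐ[A] C) : Reduction A B →+* Reduction A C :=
  Ideal.quotientMap (maxIdeal A C) f.toRingHom (by
    rw [maxIdeal, Ideal.map_le_iff_le_comap]
    intro a ha
    simpa using Ideal.mem_map_of_mem (algebraMap A C) ha)

/-- `B` is a complete residual perfection of `A` (where `A` is a discrete valuation ring of residue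
characteristic `p`): `B` is flat over `A`, complete and separated for the `𝔭_A B`-adic topology,
and `x ↦ x ^ p` is bijective on `B / 𝔭_A B`, which is an algebra over the field with `p` elements
(the zero ring is allowed). -/
structure IsCompleteResidualPerfection (p : ℕ) (A : Type u) [CommRing A] [IsLocalRing A]
    (B : Type v) [CommRing B] [Algebra A B] : Prop where
  flat : Module.Flat A B
  complete : IsAdicComplete (maxIdeal A B) B
  perfect : Function.Bijective (fun x : Reduction A B => x ^ p)

/-- `Au` is a universal residual perfection of `A`: an initial object of the category of
complete residual perfections of `A` and all `A`-algebra maps between them. -/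
structure IsUniversalResidualPerfection (p : ℕ) (A : Type u) [CommRing A] [IsLocalRing A]
    (Au : Type u) [CommRing Au] [Algebra A Au] : Prop where
  isCompleteResidualPerfection : IsCompleteResidualPerfection p A Au
  initial : ∀ (B : Type u) [CommRing B] [Algebra A B],
    IsCompleteResidualPerfection p A B → Nonempty (Unique (Au →ₐ[A] B))

/-- For a universal residual perfection `Au` of `A`, this says that `Ag` is a generic residual
perfection of `A`: a complete residual perfection of `A` whose reduction, as an algebra over the
reduction of `Au` through the map `Au → Ag` (unique if `Au` is universal), is its ring of
fractions. -/
structure IsGenericResidualPerfection (p : ℕ) (A : Type u) [CommRing A] [IsLocalRing A]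
    (Au : Type u) [CommRing Au] [Algebra A Au] (Ag : Type u) [CommRing Ag] [Algebra A Ag] :
    Prop where
  isCompleteResidualPerfection : IsCompleteResidualPerfection p A Ag
  isFractionRing : ∃ f : Au →ₐ[A] Ag,
    letI : Algebra (Reduction A Au) (Reduction A Ag) := (reductionMap f).toAlgebra
    IsFractionRing (Reduction A Au) (Reduction A Ag)

end ResidualPerfection

/-! Let `ϖ` be a uniformizer of `A`, `k` its residue field and `C` a complete residual perfection.
Each residue class of `C` contains the initial term of exactly one sequence of compatible `p`-power
roots, since elements congruent mod `ϖ` have `p ^ m`-th powers congruent mod `ϖ ^ (m + 1)`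
(`IsCompleteResidualPerfection.exists_compatible`, `compatible_ext`). Hence every element of `C` has
a unique expansion in powers of `ϖ` with such digits.

Let the `T l` in `A` lift a `p`-basis `t l` of `k`. `Model` is the generic ring in which the `T l`
have such expansions: the variables `X (l, j)` are the successive remainders, and all `p`-power
roots of the digits are adjoined. Digits and remainders being determined in `C`, the model has
exactly one map to `C` (`Model.existsUnique_algHom`). Modulo `ϖ` the digits become the `t l` and the
`X (l, j)`, so the reduction is the perfection of `k[X]`, and it is a domain because this family is
`p`-independent. The completion of the model is therefore universal; localizing at the prime
generated by `ϖ` and completing again gives a generic residual perfection.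

Now let `b` in `Ag` be algebraic over `A`. Its residue is algebraic over `k`, and `k` is
algebraically closed in `k(X)`, so some `p ^ n`-th power of the residue lies in `k`
(`exists_pow_eq_algebraMap`). The root stays in `k`: if the residue of `a` is not a `p`-th power,
`a` can be included among the `T l`, and then any `p`-th power in `Ag` congruent to `a` differs from
`a` by `ϖ` times an element with residue `-X (l, 0)`, which is transcendental
(`IsGenericResidualPerfection.not_isAlgebraic_digit`). So the integral elements algebraic over `A`
have residues in `k`, and completeness of `A` puts them in `A`. Denominators in the fraction field
of `Ag` are units times powers of `ϖ`, which settles the general case. -/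

namespace ResidualPerfection

/-! ### Monomials with exponents in `ℕ[1/p]`. -/

section RootExponents

/-- The finitely supported exponent vectors with coordinates in `ℕ[1/p]`. -/
def rootExponents (p : ℕ) (I : Type*) : AddSubmonoid (I →₀ ℚ≥0) where
  carrier := {m | ∃ (n : ℕ) (a : I →₀ ℕ), ∀ i, m i * p ^ n = a i}
  zero_mem' := ⟨0, 0, by simp⟩
  add_mem' := by
    rintro m m' ⟨n, a, h⟩ ⟨n', a', h'⟩
    refine ⟨n + n', p ^ n' • a + p ^ n • a', fun i => ?_⟩
    simp only [Finsupp.add_apply, Finsupp.smul_apply, smul_eq_mul, Nat.cast_add, Nat.cast_mul,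
      Nat.cast_pow, ← h i, ← h' i]
    ring

variable {p : ℕ} {I : Type*}

theorem exists_mul_pow_eq (m : rootExponents p I) :
    ∃ x : ℕ × (I →₀ ℕ), ∀ i, m.1 i * p ^ x.1 = x.2 i :=
  let ⟨n, a, h⟩ := m.2
  ⟨(n, a), h⟩

variable {C : Type*} [CommMonoid C] (r : I → ℕ → C)

theorem pow_pow_of_compatible {r : ℕ → C} (hr : ∀ n, r (n + 1) ^ p = r n) (n k : ℕ) :
    r (n + k) ^ p ^ k = r n := by
  induction k with
  | zero => simp
  | succ k ih => rw [← add_assoc, pow_succ', pow_mul, hr, ih]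

/-- The monomial with exponent vector `m` in a family of compatible `p`-power roots. -/
noncomputable def rootMonomial (m : rootExponents p I) : C :=
  (exists_mul_pow_eq m).choose.2.prod fun i e => r i (exists_mul_pow_eq m).choose.1 ^ e

variable {r} (hr : ∀ i n, r i (n + 1) ^ p = r i n)
include hr

theorem prod_raise (n k : ℕ) (a : I →₀ ℕ) :
    (p ^ k • a).prod (fun i e => r i (n + k) ^ e) = a.prod fun i e => r i n ^ e := by
  have h1 : ∀ c : ℕ, (c • a).prod (fun i e => r i (n + k) ^ e) =
      (a.prod fun i e => r i (n + k) ^ e) ^ c := by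
    intro c
    induction c with
    | zero => simp
    | succ c ih =>
      rw [succ_nsmul, Finsupp.prod_add_index' (by simp) (by simp [pow_add]), ih, pow_succ]
  rw [h1, Finsupp.prod, ← Finset.prod_pow]
  refine Finset.prod_congr rfl fun i _ => ?_
  rw [← pow_mul, mul_comm, pow_mul, pow_pow_of_compatible (hr i)]

/-- The chosen denominator is immaterial: presentations at levels `n` and `n'` are compared at level
`n + n'`. -/
theorem rootMonomial_eq [Fact p.Prime] {m : rootExponents p I} {n : ℕ} {a : I →₀ ℕ}
    (h : ∀ i, m.1 i * p ^ n = a i) : rootMonomial r m = a.prod fun i e => r i n ^ e := by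
  unfold rootMonomial
  have hs := (exists_mul_pow_eq m).choose_spec
  generalize (exists_mul_pow_eq m).choose = x at hs
  obtain ⟨n', a'⟩ := x
  rw [← prod_raise hr n n' a, ← prod_raise hr n' n a', add_comm n' n]
  congr 1
  ext i
  have : ((p ^ n * a' i : ℕ) : ℚ≥0) = (p ^ n' * a i : ℕ) := by
    push_cast
    rw [← h i, ← hs i]
    ring
  exact_mod_cast this

theorem rootMonomial_add [Fact p.Prime] (m m' : rootExponents p I) :
    rootMonomial r (m + m') = rootMonomial r m * rootMonomial r m' := by
  obtain ⟨⟨n, a⟩, h⟩ := exists_mul_pow_eq m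
  obtain ⟨⟨n', a'⟩, h'⟩ := exists_mul_pow_eq m'
  rw [rootMonomial_eq hr h, rootMonomial_eq hr h', ← prod_raise hr n n' a, ← prod_raise hr n' n a',
    add_comm n' n, ← Finsupp.prod_add_index' (by simp) (by simp [pow_add])]
  refine rootMonomial_eq hr fun i => ?_
  simp only at h h'
  simp only [AddSubmonoid.coe_add, Finsupp.add_apply, Finsupp.smul_apply, smul_eq_mul,
    Nat.cast_add, Nat.cast_mul, Nat.cast_pow, ← h i, ← h' i]
  ring

/-- The monoid homomorphism sending an exponent vector to the corresponding monomial in a family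
of compatible `p`-power roots. -/
noncomputable def rootMonomialHom [Fact p.Prime] : Multiplicative (rootExponents p I) →* C where
  toFun m := rootMonomial r m.toAdd
  map_one' := by
    rw [toAdd_one, rootMonomial_eq hr (n := 0) (a := 0) (by simp)]
    simp
  map_mul' m m' := rootMonomial_add hr _ _

end RootExponents

/-! ### Freeness of `ℤ[x_i^{1/p^∞}]` over `ℤ[x_i]`. -/

section Fractional

variable {p : ℕ} {I : Type*}

/-- Natural exponent vectors as exponent vectors with coordinates in `ℕ[1/p]`. -/
noncomputable def natExponent (p : ℕ) (I : Type*) : (I →₀ ℕ) →+ rootExponents p I where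
  toFun a := ⟨a.mapRange (Nat.cast : ℕ → ℚ≥0) (by simp), 0, a, by simp⟩
  map_zero' := by ext; simp
  map_add' a b := by ext; simp

@[simp] theorem natExponent_apply (a : I →₀ ℕ) (i : I) : (natExponent p I a).1 i = a i := rfl

/-- The exponent vectors with all coordinates `< 1`. -/
abbrev FractionalExponent (p : ℕ) (I : Type*) := {m : rootExponents p I // ∀ i, m.1 i < 1}

/-- The coordinatewise integral part of an exponent vector. -/
noncomputable def floorExponent (m : rootExponents p I) : I →₀ ℕ :=
  m.1.mapRange Nat.floor (by simp)

/-- The coordinatewise fractional part of an exponent vector. -/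
noncomputable def fractExponent (m : rootExponents p I) : FractionalExponent p I :=
  ⟨⟨m.1.mapRange (fun x => x - ⌊x⌋₊) (by simp), by
    obtain ⟨⟨n, a⟩, h⟩ := exists_mul_pow_eq m
    refine ⟨n, a - p ^ n • floorExponent m, fun i => ?_⟩
    have := h i
    simp only [Finsupp.mapRange_apply, tsub_mul, this, floorExponent, Finsupp.tsub_apply,
      Finsupp.smul_apply, smul_eq_mul, Nat.cast_tsub, Nat.cast_mul, Nat.cast_pow]
    rw [mul_comm]⟩, fun i => by
    simp only [Finsupp.mapRange_apply]
    rw [tsub_lt_iff_left (Nat.floor_le zero_le), ]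
    exact Nat.lt_floor_add_one _⟩

/-- Splitting an exponent vector into its fractional and its integral part. -/
noncomputable def exponentEquiv (p : ℕ) (I : Type*) :
    rootExponents p I ≃ FractionalExponent p I × (I →₀ ℕ) where
  toFun m := (fractExponent m, floorExponent m)
  invFun x := x.1.1 + natExponent p I x.2
  left_inv m := by
    ext i
    simp [fractExponent, floorExponent, tsub_add_cancel_of_le (Nat.floor_le zero_le)]
  right_inv x := by
    obtain ⟨q, a⟩ := x
    have h : ∀ i, ⌊q.1.1 i + a i⌋₊ = a i := fun i => by
      rw [Nat.floor_add_natCast zero_le, Nat.floor_eq_zero.2 (q.2 i), zero_add]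
    refine Prod.ext ?_ ?_
    · ext i
      simp [fractExponent, h]
    · ext i
      simp [floorExponent, h]

/-- `ℤ[x_i^{1/p^∞}]` -/
abbrev RootAlgebra (p : ℕ) (I : Type*) := AddMonoidAlgebra ℤ (rootExponents p I)

noncomputable instance : Algebra (MvPolynomial I ℤ) (RootAlgebra p I) :=
  (AddMonoidAlgebra.mapDomainRingHom ℤ (natExponent p I)).toAlgebra

theorem monomial_smul_single (a : I →₀ ℕ) (c d : ℤ) (m : rootExponents p I) :
    MvPolynomial.monomial a c • (AddMonoidAlgebra.single m d : RootAlgebra p I) =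
      AddMonoidAlgebra.single (m + natExponent p I a) (c * d) := by
  rw [Algebra.smul_def]
  change AddMonoidAlgebra.mapDomain _ (AddMonoidAlgebra.single a c) * _ = _
  rw [AddMonoidAlgebra.mapDomain_single, AddMonoidAlgebra.single_mul_single, add_comm]

/-- Exponents split uniquely into a fractional and an integral part, so the map merely regroups
coefficients; `e` is this regrouping, by currying. -/
theorem linearCombination_bijective : Function.Bijective
    (Finsupp.linearCombination (MvPolynomial I ℤ) fun q : FractionalExponent p I =>
      (AddMonoidAlgebra.single q.1 1 : RootAlgebra p I)) := by
  let e : (FractionalExponent p I →₀ MvPolynomial I ℤ) ≃+ RootAlgebra p I :=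
    (Finsupp.mapRange.addEquiv (AddMonoidAlgebra.coeffAddEquiv (R := ℤ) (M := I →₀ ℕ))).trans <|
      (Finsupp.curryAddEquiv (M := ℤ)).symm.trans <|
      (Finsupp.domCongr (exponentEquiv p I).symm).trans AddMonoidAlgebra.coeffAddEquiv.symm
  have : (Finsupp.linearCombination (MvPolynomial I ℤ) fun q : FractionalExponent p I =>
      (AddMonoidAlgebra.single q.1 1 : RootAlgebra p I)).toAddMonoidHom = e.toAddMonoidHom := by
    refine Finsupp.addHom_ext fun q f => ?_
    induction f using MvPolynomial.induction_on' with
    | monomial a c =>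
      have : e (Finsupp.single q (MvPolynomial.monomial a c)) =
          AddMonoidAlgebra.single (q.1 + natExponent p I a) c := by
        change AddMonoidAlgebra.ofCoeff (Finsupp.equivMapDomain _ (Finsupp.uncurry
          (Finsupp.mapRange AddMonoidAlgebra.coeffAddEquiv (map_zero _)
            (Finsupp.single q _)))) = _
        rw [Finsupp.mapRange_single]
        change AddMonoidAlgebra.ofCoeff (Finsupp.equivMapDomain _ (Finsupp.uncurry
          (Finsupp.single q (Finsupp.single a c)))) = _
        rw [Finsupp.uncurry_single, Finsupp.equivMapDomain_single]
        rfl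
      simpa [monomial_smul_single] using this.symm
    | add f g hf hg => rw [Finsupp.single_add, map_add, map_add, hf, hg]
  rw [show ⇑(Finsupp.linearCombination (MvPolynomial I ℤ) fun q : FractionalExponent p I =>
      (AddMonoidAlgebra.single q.1 1 : RootAlgebra p I)) = e from
      funext fun x => DFunLike.congr_fun this x]
  exact e.bijective

/-- The fractional monomials form a basis of `ℤ[x_i^{1/p^∞}]` over `ℤ[x_i]`. -/
noncomputable def rootAlgebraBasis (p : ℕ) (I : Type*) :
    Module.Basis (FractionalExponent p I) (MvPolynomial I ℤ) (RootAlgebra p I) :=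
  .ofRepr (LinearEquiv.ofBijective _ linearCombination_bijective).symm

theorem rootAlgebraBasis_apply (q : FractionalExponent p I) :
    rootAlgebraBasis p I q = AddMonoidAlgebra.single q.1 1 := by
  rw [rootAlgebraBasis, Module.Basis.coe_ofRepr]
  simp

end Fractional

/-! ### Adjoining `p`-power roots over any ring, by base change from the universal case. -/

section RootRing

open TensorProduct

variable (p : ℕ) {I : Type*} {P : Type*} [CommRing P] (s : I → P)

/-- The ring obtained from `P` by freely adjoining compatible `p`-power roots of the elements
`s i`. -/
def RootRing : Type _ :=
  letI := (MvPolynomial.aeval s : MvPolynomial I ℤ →ₐ[ℤ] P).toAlgebra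
  P ⊗[MvPolynomial I ℤ] RootAlgebra p I

noncomputable instance : CommRing (RootRing p s) :=
  letI := (MvPolynomial.aeval s : MvPolynomial I ℤ →ₐ[ℤ] P).toAlgebra
  (inferInstance : CommRing (P ⊗[MvPolynomial I ℤ] RootAlgebra p I))

noncomputable instance : Algebra P (RootRing p s) :=
  letI := (MvPolynomial.aeval s : MvPolynomial I ℤ →ₐ[ℤ] P).toAlgebra
  (inferInstance : Algebra P (P ⊗[MvPolynomial I ℤ] RootAlgebra p I))

/-- The canonical map `ℤ[x_i^{1/p^∞}] → P[s_i^{1/p^∞}]`. -/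
noncomputable def ofRootAlgebra : RootAlgebra p I →+* RootRing p s :=
  letI := (MvPolynomial.aeval s : MvPolynomial I ℤ →ₐ[ℤ] P).toAlgebra
  (Algebra.TensorProduct.includeRight :
    RootAlgebra p I →ₐ[MvPolynomial I ℤ] P ⊗[MvPolynomial I ℤ] RootAlgebra p I).toRingHom

/-- The monomial with exponent vector `m` in the roots of the `s i`. -/
noncomputable def rmonomial (m : rootExponents p I) : RootRing p s :=
  ofRootAlgebra p s (AddMonoidAlgebra.single m 1)

/-- The fractional monomials form a basis of `RootRing p s` over `P`. -/
noncomputable def rootRingBasis : Module.Basis (FractionalExponent p I) P (RootRing p s) :=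
  letI := (MvPolynomial.aeval s : MvPolynomial I ℤ →ₐ[ℤ] P).toAlgebra
  Algebra.TensorProduct.basis P (rootAlgebraBasis p I)

theorem rootRingBasis_apply (q : FractionalExponent p I) :
    rootRingBasis p s q = rmonomial p s q.1 := by
  let := (MvPolynomial.aeval s : MvPolynomial I ℤ →ₐ[ℤ] P).toAlgebra
  change Algebra.TensorProduct.basis P (rootAlgebraBasis p I) q = _
  rw [Algebra.TensorProduct.basis_apply, rootAlgebraBasis_apply]
  rfl

theorem rmonomial_add (m m' : rootExponents p I) :
    rmonomial p s (m + m') = rmonomial p s m * rmonomial p s m' := by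
  rw [rmonomial, rmonomial, rmonomial, ← map_mul, AddMonoidAlgebra.single_mul_single, mul_one]

theorem rmonomial_zero : rmonomial p s 0 = 1 := map_one (ofRootAlgebra p s)

theorem rmonomial_nsmul (n : ℕ) (m : rootExponents p I) :
    rmonomial p s (n • m) = rmonomial p s m ^ n := by
  induction n with
  | zero => rw [zero_smul, pow_zero, rmonomial_zero]
  | succ n ih => rw [succ_nsmul, rmonomial_add, ih, pow_succ]

theorem rmonomial_natExponent (a : I →₀ ℕ) :
    rmonomial p s (natExponent p I a) = algebraMap P _ (a.prod fun i e => s i ^ e) := by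
  let := (MvPolynomial.aeval s : MvPolynomial I ℤ →ₐ[ℤ] P).toAlgebra
  have h1 : (AddMonoidAlgebra.single (natExponent p I a) 1 : RootAlgebra p I) =
      algebraMap (MvPolynomial I ℤ) _ (MvPolynomial.monomial a 1) := by
    rw [Algebra.algebraMap_eq_smul_one, AddMonoidAlgebra.one_def, monomial_smul_single, zero_add,
      mul_one]
  have h2 : (a.prod fun i e => s i ^ e) =
      algebraMap (MvPolynomial I ℤ) P (MvPolynomial.monomial a 1) := by
    change _ = MvPolynomial.aeval s _
    rw [MvPolynomial.aeval_monomial, map_one, one_mul]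
  rw [rmonomial, h1, h2]
  exact (Algebra.TensorProduct.includeRight : RootAlgebra p I →ₐ[MvPolynomial I ℤ]
    P ⊗[MvPolynomial I ℤ] RootAlgebra p I).commutes _

/-- The exponent vector with a single coordinate `1 / p ^ n`. -/
noncomputable def rootExponent [Fact p.Prime] (i : I) (n : ℕ) : rootExponents p I :=
  ⟨Finsupp.single i (1 / p ^ n), n, Finsupp.single i 1, fun j => by
    have : (p : ℚ≥0) ≠ 0 := by exact_mod_cast (Fact.out : p.Prime).ne_zero
    classical
    rw [Finsupp.single_apply, Finsupp.single_apply]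
    split_ifs <;> simp [this]⟩

variable [Fact p.Prime]

/-- The `p ^ n`-th root of `s i` -/
noncomputable def sroot (i : I) (n : ℕ) : RootRing p s := rmonomial p s (rootExponent p i n)

theorem sroot_zero (i : I) : sroot p s i 0 = algebraMap P _ (s i) := by
  have : rootExponent p i 0 = natExponent p I (Finsupp.single i 1) := by
    ext j
    classical
    simp [rootExponent, Finsupp.single_apply, apply_ite]
  rw [sroot, this, rmonomial_natExponent]
  simp

theorem sroot_succ_pow (i : I) (n : ℕ) : sroot p s i (n + 1) ^ p = sroot p s i n := by
  rw [sroot, sroot, ← rmonomial_nsmul]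
  congr 1
  ext j
  have : (p : ℚ≥0) ≠ 0 := by exact_mod_cast (Fact.out : p.Prime).ne_zero
  classical
  simp only [rootExponent, AddSubmonoidClass.coe_nsmul, Finsupp.smul_apply, Finsupp.single_apply]
  split_ifs
  · rw [pow_succ, nsmul_eq_mul, mul_one_div, mul_comm, div_mul_cancel_left₀ this, one_div]
  · simp

theorem sum_rootExponent {m : rootExponents p I} {n : ℕ} {a : I →₀ ℕ}
    (h : ∀ i, m.1 i * p ^ n = a i) : m = a.sum fun i e => e • rootExponent p i n := by
  ext j
  have : (p : ℚ≥0) ≠ 0 := by exact_mod_cast (Fact.out : p.Prime).ne_zero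
  classical
  rw [Finsupp.sum, AddSubmonoid.coe_finsetSum, Finsupp.finsetSum_apply,
    Finset.sum_eq_single j]
  · have h := h j
    simp only [rootExponent, AddSubmonoidClass.coe_nsmul, Finsupp.smul_apply, Finsupp.single_eq_same,
      nsmul_eq_mul, ← h]
    field_simp
  · intro i _ hi
    simp [rootExponent, hi.symm]
  · intro hj
    simp [Finsupp.notMem_support_iff.1 hj]

theorem rmonomial_eq_prod {m : rootExponents p I} {n : ℕ} {a : I →₀ ℕ}
    (h : ∀ i, m.1 i * p ^ n = a i) :
    rmonomial p s m = a.prod fun i e => sroot p s i n ^ e := by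
  rw [sum_rootExponent p h, Finsupp.sum, Finsupp.prod]
  generalize a.support = t
  classical
  induction t using Finset.induction_on with
  | empty => simp [rmonomial_zero]
  | insert i t hi ih =>
    rw [Finset.sum_insert hi, Finset.prod_insert hi, rmonomial_add, rmonomial_nsmul, ih]
    rfl

theorem adjoin_sroot :
    Algebra.adjoin P (Set.range fun x : I × ℕ => sroot p s x.1 x.2) = ⊤ := by
  rw [eq_top_iff]
  rintro x -
  rw [← (rootRingBasis p s).linearCombination_repr x, Finsupp.linearCombination_apply]
  refine Subalgebra.sum_mem _ fun q _ => Subalgebra.smul_mem _ ?_ _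
  obtain ⟨⟨n, a⟩, h⟩ := exists_mul_pow_eq q.1
  rw [rootRingBasis_apply, rmonomial_eq_prod p s h]
  exact Subalgebra.prod_mem _ fun i _ =>
    Subalgebra.pow_mem _ (Algebra.subset_adjoin (Set.mem_range_self (i, n))) _

theorem RootRing.ringHom_ext {C : Type*} [CommRing C] {F G : RootRing p s →+* C}
    (h : ∀ x, F (algebraMap P _ x) = G (algebraMap P _ x))
    (h' : ∀ i n, F (sroot p s i n) = G (sroot p s i n)) : F = G := by
  ext x
  have hx : x ∈ Algebra.adjoin P (Set.range fun x : I × ℕ => sroot p s x.1 x.2) := by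
    rw [adjoin_sroot]; trivial
  induction hx using Algebra.adjoin_induction with
  | mem x hx => obtain ⟨x, rfl⟩ := hx; exact h' _ _
  | algebraMap r => exact h r
  | add x y _ _ hx hy => rw [map_add, map_add, hx, hy]
  | mul x y _ _ hx hy => rw [map_mul, map_mul, hx, hy]

theorem RootRing.exists_lift {C : Type*} [CommRing C] (f : P →+* C) (r : I → ℕ → C)
    (h0 : ∀ i, r i 0 = f (s i)) (hr : ∀ i n, r i (n + 1) ^ p = r i n) :
    ∃ F : RootRing p s →+* C, (∀ x, F (algebraMap P _ x) = f x) ∧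
      ∀ i n, F (sroot p s i n) = r i n := by
  let := (MvPolynomial.aeval s : MvPolynomial I ℤ →ₐ[ℤ] P).toAlgebra
  let : Algebra (MvPolynomial I ℤ) C := (f.comp (algebraMap (MvPolynomial I ℤ) P)).toAlgebra
  let f' : P →ₐ[MvPolynomial I ℤ] C := { f with commutes' := fun _ => rfl }
  let g₀ : RootAlgebra p I →ₐ[ℤ] C := AddMonoidAlgebra.lift ℤ C _ (rootMonomialHom hr)
  have hg₀ : ∀ m, g₀ (AddMonoidAlgebra.single m 1) = rootMonomial r m := fun m => by
    rw [AddMonoidAlgebra.lift_single, one_smul]; rfl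
  let g : RootAlgebra p I →ₐ[MvPolynomial I ℤ] C :=
    { g₀.toRingHom with
      commutes' := fun x => by
        have : (g₀.toRingHom.comp (algebraMap (MvPolynomial I ℤ) (RootAlgebra p I))) =
            f.comp (algebraMap (MvPolynomial I ℤ) P) := by
          refine MvPolynomial.ringHom_ext (fun c => by simp) fun i => ?_
          have h1 : algebraMap (MvPolynomial I ℤ) (RootAlgebra p I) (MvPolynomial.X i) =
              AddMonoidAlgebra.single (natExponent p I (Finsupp.single i 1)) 1 := by
            rw [Algebra.algebraMap_eq_smul_one, AddMonoidAlgebra.one_def, MvPolynomial.X,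
              monomial_smul_single, zero_add, mul_one]
          have h2 : algebraMap (MvPolynomial I ℤ) P (MvPolynomial.X i) = s i :=
            MvPolynomial.aeval_X _ _
          rw [RingHom.comp_apply, RingHom.comp_apply, h1, h2]
          refine (hg₀ _).trans ?_
          rw [rootMonomial_eq hr (n := 0) (a := Finsupp.single i 1) (by simp)]
          simp [h0]
        exact DFunLike.congr_fun this x }
  refine ⟨(Algebra.TensorProduct.lift f' g fun _ _ => Commute.all _ _).toRingHom, fun x => ?_,
    fun i n => ?_⟩
  · change Algebra.TensorProduct.lift f' g _ (x ⊗ₜ[MvPolynomial I ℤ] 1) = _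
    rw [Algebra.TensorProduct.lift_tmul, map_one, mul_one]
    rfl
  · change Algebra.TensorProduct.lift f' g _
      (1 ⊗ₜ[MvPolynomial I ℤ] AddMonoidAlgebra.single (rootExponent p i n) 1) = _
    rw [Algebra.TensorProduct.lift_tmul, map_one, one_mul]
    refine (hg₀ _).trans ?_
    rw [rootMonomial_eq hr (n := n) (a := Finsupp.single i 1)]
    · simp
    · intro j
      have : (p : ℚ≥0) ≠ 0 := by exact_mod_cast (Fact.out : p.Prime).ne_zero
      classical
      simp only [rootExponent, Finsupp.single_apply]
      split_ifs <;> simp [this]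

end RootRing

/-! ### `p`-independent families and polynomial rings. -/

section PIndependent

/-- A family `s` in a ring of characteristic `p` is `p`-independent if the monomials in `s` with
exponents `< p` are linearly independent over the subring of `p`-th powers. -/
def PIndependent (p : ℕ) {I R : Type*} [CommRing R] (s : I → R) : Prop :=
  ∀ (t : Finset (I →₀ ℕ)) (c : (I →₀ ℕ) → R), (∀ a ∈ t, ∀ i, a i < p) →
    ∑ a ∈ t, c a ^ p * (a.prod fun i e => s i ^ e) = 0 → ∀ a ∈ t, c a = 0

variable {p : ℕ} {I R : Type*} [CommRing R] {s : I → R}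

theorem PIndependent.eq_zero (hs : PIndependent p s) {ι : Type*} (t : Finset ι) (a : ι → I →₀ ℕ)
    (ha : Set.InjOn a t) (hap : ∀ x ∈ t, ∀ i, a x i < p) (c : ι → R)
    (h : ∑ x ∈ t, c x ^ p * ((a x).prod fun i e => s i ^ e) = 0) : ∀ x ∈ t, c x = 0 := by
  classical
  rcases isEmpty_or_nonempty ι with hι | hι
  · exact fun x => (hι.false x).elim
  have hinv : ∀ x ∈ t, Function.invFunOn a t (a x) = x := fun x hx =>
    ha.leftInvOn_invFunOn hx
  intro x hx
  have := hs (t.image a) (fun b => c (Function.invFunOn a t b)) ?_ ?_ (a x)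
    (Finset.mem_image_of_mem _ hx)
  · simpa only [hinv x hx] using this
  · intro b hb
    obtain ⟨y, hy, rfl⟩ := Finset.mem_image.1 hb
    exact hap y hy
  · rw [Finset.sum_image ha, ← h]
    exact Finset.sum_congr rfl fun y hy => by rw [hinv y hy]

theorem coeff_smul_pow [Fact p.Prime] {J k : Type*} [CommRing k] [CharP k p]
    (f : MvPolynomial J k) (m : J →₀ ℕ) :
    (f ^ p).coeff (p • m) = f.coeff m ^ p := by
  have : ExpChar k p := .prime Fact.out
  rw [← MvPolynomial.map_frobenius_expand, MvPolynomial.coeff_map,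
    MvPolynomial.coeff_expand_smul _ (Fact.out : p.Prime).ne_zero]
  rfl

theorem coeff_pow_eq_zero [Fact p.Prime] {J k : Type*} [CommRing k] [CharP k p]
    (f : MvPolynomial J k) (m : J →₀ ℕ) (hm : ∃ j, ¬ p ∣ m j) :
    (f ^ p).coeff m = 0 := by
  have : ExpChar k p := .prime Fact.out
  obtain ⟨j, hj⟩ := hm
  rw [← MvPolynomial.map_frobenius_expand, MvPolynomial.coeff_map,
    MvPolynomial.coeff_expand_of_not_dvd _ hj, map_zero]

/-- A `p`-th power only involves monomials with exponents divisible by `p`, so exponents of the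
variables below `p` can be read off modulo `p`. This separates a relation into relations among the
`t l`. -/
theorem PIndependent.sumElim [Fact p.Prime] {Λ J k : Type*} [CommRing k] [CharP k p] {t : Λ → k}
    (ht : PIndependent p t) :
    PIndependent p (Sum.elim (fun l => MvPolynomial.C (t l)) MvPolynomial.X :
      Λ ⊕ J → MvPolynomial J k) := by
  classical
  intro T c hT h b hb
  set e := Finsupp.sumFinsuppEquivProdFinsupp (α := Λ) (β := J) (γ := ℕ) with he
  have he1 : ∀ a l, (e a).1 l = a (Sum.inl l) := fun a l => rfl
  have he2 : ∀ a l, (e a).2 l = a (Sum.inr l) := fun a l => rfl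
  have hprod : ∀ a : Λ ⊕ J →₀ ℕ, (a.prod fun i e => (Sum.elim (fun l => MvPolynomial.C (t l))
      MvPolynomial.X : Λ ⊕ J → MvPolynomial J k) i ^ e) =
      MvPolynomial.monomial (e a).2 ((e a).1.prod fun i e => t i ^ e) := by
    intro a
    obtain ⟨⟨x, y⟩, rfl⟩ := e.symm.surjective a
    rw [Equiv.apply_symm_apply, MvPolynomial.monomial_eq]
    change (Finsupp.sumElim x y).prod _ = _
    rw [Finsupp.prod_sumElim, map_finsuppProd]
    simp only [map_pow]
    rfl
  ext m
  rw [MvPolynomial.coeff_zero]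
  -- At this coefficient only the terms with the same variable exponents as `b` survive, and they
  -- contribute the `p`-th powers of the coefficients at `m`.
  have hc := congr_arg (MvPolynomial.coeff (p • m + (e b).2)) h
  rw [MvPolynomial.coeff_zero, MvPolynomial.coeff_sum] at hc
  refine ht.eq_zero (T.filter fun a => (e a).2 = (e b).2) (fun a => (e a).1) ?_ ?_
    (fun a => (c a).coeff m) ?_ b (by simpa using hb)
  · intro a ha a' ha' haa
    simp only [Finset.coe_filter, Set.mem_ofPred_eq] at ha ha'
    exact e.injective (Prod.ext haa (ha.2.trans ha'.2.symm))
  · intro a ha l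
    exact hT a (Finset.mem_filter.1 ha).1 _
  · rw [Finset.sum_filter]
    refine (Finset.sum_congr rfl fun a ha => ?_).trans hc
    rw [hprod, MvPolynomial.coeff_mul_monomial']
    split_ifs with h1 h2 h2
    · rw [h1, add_tsub_cancel_right, coeff_smul_pow]
    · rw [h1] at h2
      exact (h2 le_add_self).elim
    · rw [coeff_pow_eq_zero, zero_mul]
      by_contra! hdvd
      refine h1 (Finsupp.ext fun j => ?_)
      have h3 := hdvd j
      have h4 := h2 j
      have h5 := hT a ha (Sum.inr j)
      have h6 := hT b hb (Sum.inr j)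
      rw [← he2] at h5 h6
      simp only [Finsupp.tsub_apply, Finsupp.add_apply, Finsupp.smul_apply, smul_eq_mul] at h3 h4
      have h7 : (p * m j + (e b).2 j) ≡ (e a).2 j [MOD p] := ((Nat.modEq_iff_dvd' h4).2 h3).symm
      have h8 : (e b).2 j ≡ (e a).2 j [MOD p] := by
        rwa [Nat.ModEq, Nat.mul_add_mod] at h7
      exact (Nat.ModEq.eq_of_lt_of_lt h8 h6 h5).symm
    · rfl

end PIndependent

/-! ### Root rings in characteristic `p`: reducedness and integrality. -/

section RootRingCharP

variable {p : ℕ} [Fact p.Prime] {I R : Type*} [CommRing R] {s : I → R}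

omit [Fact p.Prime] in
theorem rootRingBasis_zero :
    rootRingBasis p s ⟨0, fun _ => by simp⟩ = 1 := by
  rw [rootRingBasis_apply, rmonomial_zero]

omit [Fact p.Prime] in
theorem RootRing.algebraMap_injective : Function.Injective (algebraMap R (RootRing p s)) := by
  intro x y h
  rw [Algebra.algebraMap_eq_smul_one, Algebra.algebraMap_eq_smul_one, ← rootRingBasis_zero] at h
  have := congr_arg (fun z => (rootRingBasis p s).repr z ⟨0, fun _ => by simp⟩) h
  simpa using this

omit [Fact p.Prime] in
theorem RootRing.eq_zero_of_mul_eq_zero [IsDomain R] {x : R} (hx : x ≠ 0) {d : RootRing p s}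
    (hd : algebraMap R _ x * d = 0) : d = 0 := by
  have h1 : x • (rootRingBasis p s).repr d = 0 := by
    rw [← LinearEquiv.map_smul, Algebra.smul_def, hd, map_zero]
  have h2 : (rootRingBasis p s).repr d = 0 := by
    ext1 q
    have h3 := DFunLike.congr_fun h1 q
    rw [Finsupp.smul_apply, smul_eq_mul, Finsupp.zero_apply, mul_eq_zero] at h3
    exact h3.resolve_left hx
  exact (LinearEquiv.map_eq_zero_iff _).1 h2

/-- True for the adjoined roots, and preserved by sums because Frobenius is additive. -/
theorem RootRing.exists_pow_mem_range [CharP R p] (d : RootRing p s) :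
    ∃ (n : ℕ) (x : R), d ^ p ^ n = algebraMap R _ x := by
  have : CharP (RootRing p s) p := charP_of_injective_algebraMap algebraMap_injective p
  have : ExpChar (RootRing p s) p := .prime Fact.out
  have hd : d ∈ Algebra.adjoin R (Set.range fun x : I × ℕ => sroot p s x.1 x.2) := by
    rw [adjoin_sroot]; trivial
  have raise : ∀ (d : RootRing p s) (n k : ℕ) (x : R), d ^ p ^ n = algebraMap R _ x →
      d ^ p ^ (n + k) = algebraMap R _ (x ^ p ^ k) := fun d n k x h => by
    rw [pow_add, pow_mul, h, map_pow]
  induction hd using Algebra.adjoin_induction with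
  | mem x hx =>
    obtain ⟨⟨i, n⟩, rfl⟩ := hx
    refine ⟨n, s i, ?_⟩
    rw [← sroot_zero]
    have := pow_pow_of_compatible (sroot_succ_pow p s i) 0 n
    rwa [zero_add] at this
  | algebraMap r => exact ⟨0, r, by simp⟩
  | add x y _ _ hx hy =>
    obtain ⟨n, a, ha⟩ := hx
    obtain ⟨m, b, hb⟩ := hy
    refine ⟨n + m, a ^ p ^ m + b ^ p ^ n, ?_⟩
    rw [add_pow_expChar_pow, raise _ _ m _ ha, add_comm n m, raise _ _ n _ hb, map_add]
  | mul x y _ _ hx hy =>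
    obtain ⟨n, a, ha⟩ := hx
    obtain ⟨m, b, hb⟩ := hy
    refine ⟨n + m, a ^ p ^ m * b ^ p ^ n, ?_⟩
    rw [mul_pow, raise _ _ m _ ha, add_comm n m, raise _ _ n _ hb, map_mul]

/-- Expanding `d` in fractional monomials, the `p`-th power of the monomial `q` is an integral
monomial times the fractional part of `p • q`. Among the `q` sharing that fractional part the
integral parts are distinct with entries below `p`, so each coordinate of `d ^ p = 0` is a relation
of the kind excluded by `p`-independence. -/
theorem RootRing.pow_eq_zero [CharP R p] (hs : PIndependent p s) {d : RootRing p s}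
    (hd : d ^ p = 0) : d = 0 := by
  classical
  have : CharP (RootRing p s) p := charP_of_injective_algebraMap algebraMap_injective p
  have : ExpChar (RootRing p s) p := .prime Fact.out
  set B := rootRingBasis p s with hB
  set e := exponentEquiv p I with he
  have hp : (0 : ℚ≥0) < p := by exact_mod_cast (Fact.out : p.Prime).pos
  have hdec : ∀ m, (e m).1.1 + natExponent p I (e m).2 = m := fun m => e.symm_apply_apply m
  have hB' : ∀ q : FractionalExponent p I, B q ^ p =
      ((e (p • q.1)).2.prod fun i e => s i ^ e) • B (e (p • q.1)).1 := by
    intro q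
    rw [rootRingBasis_apply, rootRingBasis_apply, ← rmonomial_nsmul, Algebra.smul_def,
      ← rmonomial_natExponent, ← rmonomial_add, add_comm, hdec]
  have hsum : d ^ p = ∑ q ∈ (B.repr d).support,
      (B.repr d q ^ p * (e (p • q.1)).2.prod fun i e => s i ^ e) • B (e (p • q.1)).1 := by
    conv_lhs => rw [← B.linearCombination_repr d, Finsupp.linearCombination_apply, Finsupp.sum,
      sum_pow_char]
    refine Finset.sum_congr rfl fun q _ => ?_
    rw [smul_pow, hB', mul_smul]
  rw [hd] at hsum
  have hzero : ∀ q ∈ (B.repr d).support, B.repr d q = 0 := by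
    intro q hq
    refine hs.eq_zero ((B.repr d).support.filter fun q' => (e (p • q'.1)).1 = (e (p • q.1)).1)
      (fun q' => (e (p • q'.1)).2) ?_ ?_ (fun q' => B.repr d q') ?_ q (by simpa using hq)
    · intro x hx y hy hxy
      simp only [Finset.coe_filter, Set.mem_ofPred_eq] at hx hy
      have h1 : p • x.1 = p • y.1 := e.injective (Prod.ext (hx.2.trans hy.2.symm) hxy)
      ext i
      have h2 := congr_arg (fun m : rootExponents p I => m.1 i) h1
      simp only [AddSubmonoidClass.coe_nsmul, Finsupp.smul_apply, nsmul_eq_mul] at h2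
      exact congr_arg _ (mul_left_cancel₀ hp.ne' h2)
    · intro x _ i
      have h1 : ((e (p • x.1)).2 i : ℚ≥0) ≤ (p • x.1).1 i := by
        conv_rhs => rw [← hdec (p • x.1)]
        simp
      have h2 : (p • x.1).1 i < p := by
        simp only [AddSubmonoidClass.coe_nsmul, Finsupp.smul_apply, nsmul_eq_mul]
        exact mul_lt_of_lt_one_right hp (x.2 i)
      exact_mod_cast h1.trans_lt h2
    · have h1 := congr_arg (fun z => B.repr z (e (p • q.1)).1) hsum
      simp only [map_zero, map_sum, map_smul, Module.Basis.repr_self, Finsupp.smul_single,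
        smul_eq_mul, mul_one, Finsupp.coe_zero, Pi.zero_apply, Finsupp.finsetSum_apply,
        Finsupp.single_apply] at h1
      rw [Finset.sum_filter, ← h1]
  have : B.repr d = 0 := by
    ext q
    by_cases hq : q ∈ (B.repr d).support
    · exact hzero q hq
    · exact Finsupp.notMem_support_iff.1 hq
  simpa using this

theorem RootRing.frobenius_injective [CharP R p] (hs : PIndependent p s) :
    Function.Injective fun d : RootRing p s => d ^ p := by
  have : CharP (RootRing p s) p := charP_of_injective_algebraMap algebraMap_injective p
  have : ExpChar (RootRing p s) p := .prime Fact.out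
  intro x y h
  rw [← sub_eq_zero]
  refine pow_eq_zero hs ?_
  rw [sub_pow_expChar, sub_eq_zero]
  exact h

/-- Zero divisors have `p`-power powers in the domain `R`, one of which vanishes; reducedness then
finishes. -/
theorem RootRing.isDomain [IsDomain R] [CharP R p] (hs : PIndependent p s) :
    IsDomain (RootRing p s) := by
  have hred : ∀ (n : ℕ) (d : RootRing p s), d ^ p ^ n = 0 → d = 0 := by
    intro n
    induction n with
    | zero => intro d; simp
    | succ n ih =>
      intro d h
      rw [pow_succ', pow_mul] at h
      exact pow_eq_zero hs (ih _ h)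
  have : Nontrivial (RootRing p s) := algebraMap_injective.nontrivial (α := R)
  have : NoZeroDivisors (RootRing p s) := ⟨by
    intro a b hab
    obtain ⟨n, x, hx⟩ := exists_pow_mem_range a
    obtain ⟨m, y, hy⟩ := exists_pow_mem_range b
    have : algebraMap R (RootRing p s) (x ^ p ^ m * y ^ p ^ n) = 0 := by
      rw [map_mul, map_pow, map_pow, ← hx, ← hy, ← pow_mul, ← pow_mul, mul_comm (p ^ m),
        ← mul_pow, hab, zero_pow]
      have := (Fact.out : p.Prime).ne_zero
      positivity
    rw [map_eq_zero_iff _ algebraMap_injective, mul_eq_zero] at this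
    refine this.imp (fun h => hred n _ ?_) (fun h => hred m _ ?_)
    · rw [hx, eq_zero_of_pow_eq_zero h, map_zero]
    · rw [hy, eq_zero_of_pow_eq_zero h, map_zero]⟩
  exact NoZeroDivisors.to_isDomain _

end RootRingCharP

/-! ### Root rings under change of the base ring. -/

section BaseChange

variable {p : ℕ} [Fact p.Prime] {I P R : Type*} [CommRing P] [CommRing R] (φ : P →+* R)
  (s : I → P)

theorem RootRing.exists_baseChange : ∃ Φ : RootRing p s →+* RootRing p (fun i => φ (s i)),
    (∀ x, Φ (algebraMap P _ x) = algebraMap R _ (φ x)) ∧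
      ∀ i n, Φ (sroot p s i n) = sroot p (fun i => φ (s i)) i n :=
  RootRing.exists_lift p s ((algebraMap R _).comp φ) (sroot p fun i => φ (s i))
    (fun i => sroot_zero p _ i) (sroot_succ_pow p _)

variable {φ s} {Φ : RootRing p s →+* RootRing p (fun i => φ (s i))}
  (h1 : ∀ x, Φ (algebraMap P _ x) = algebraMap R _ (φ x))
  (h2 : ∀ i n, Φ (sroot p s i n) = sroot p (fun i => φ (s i)) i n)
include h1 h2

omit h1 in
theorem RootRing.baseChange_basis (q : FractionalExponent p I) :
    Φ (rootRingBasis p s q) = rootRingBasis p (fun i => φ (s i)) q := by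
  obtain ⟨⟨n, a⟩, h⟩ := exists_mul_pow_eq q.1
  rw [rootRingBasis_apply, rootRingBasis_apply, rmonomial_eq_prod p _ h, rmonomial_eq_prod p _ h,
    Finsupp.prod, map_prod]
  simp only [map_pow, h2]
  rfl

theorem RootRing.baseChange_surjective (hφ : Function.Surjective φ) : Function.Surjective Φ := by
  intro y
  have hy : y ∈ Algebra.adjoin R (Set.range fun x : I × ℕ => sroot p (fun i => φ (s i)) x.1 x.2) :=
    by rw [adjoin_sroot]; trivial
  induction hy using Algebra.adjoin_induction with
  | mem x hx => obtain ⟨⟨i, n⟩, rfl⟩ := hx; exact ⟨_, h2 i n⟩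
  | algebraMap r => obtain ⟨x, rfl⟩ := hφ r; exact ⟨_, h1 x⟩
  | add x y _ _ hx hy =>
    obtain ⟨a, rfl⟩ := hx
    obtain ⟨b, rfl⟩ := hy
    exact ⟨a + b, map_add _ _ _⟩
  | mul x y _ _ hx hy =>
    obtain ⟨a, rfl⟩ := hx
    obtain ⟨b, rfl⟩ := hy
    exact ⟨a * b, map_mul _ _ _⟩

/-- Fractional monomials map to fractional monomials, so `Φ` acts as `φ` on coordinates. -/
theorem RootRing.dvd_of_baseChange_eq_zero {ϖ : P} (hφ : ∀ x, φ x = 0 → ϖ ∣ x) {d : RootRing p s}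
    (hd : Φ d = 0) : algebraMap P _ ϖ ∣ d := by
  have hsum : Φ d = ∑ q ∈ ((rootRingBasis p s).repr d).support,
      φ ((rootRingBasis p s).repr d q) • rootRingBasis p (fun i => φ (s i)) q := by
    conv_lhs => rw [← (rootRingBasis p s).linearCombination_repr d,
      Finsupp.linearCombination_apply, Finsupp.sum, map_sum]
    refine Finset.sum_congr rfl fun q _ => ?_
    rw [Algebra.smul_def, map_mul, h1, baseChange_basis h2, Algebra.smul_def]
  have hcoord : ∀ q ∈ ((rootRingBasis p s).repr d).support,
      φ ((rootRingBasis p s).repr d q) = 0 := by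
    intro q hq
    have h := congr_arg (fun z => (rootRingBasis p (fun i => φ (s i))).repr z q) (hsum.symm.trans hd)
    classical
    simpa [Finsupp.single_apply, Finsupp.finsetSum_apply, hq] using h
  rw [← (rootRingBasis p s).linearCombination_repr d, Finsupp.linearCombination_apply, Finsupp.sum]
  refine Finset.dvd_sum fun q hq => ?_
  rw [Algebra.smul_def]
  exact Dvd.dvd.mul_right (map_dvd _ (hφ _ (hcoord q hq))) _

end BaseChange

/-! ### Existence of `p`-bases of fields. -/

section PBasis

variable {p : ℕ} {k : Type*} [Field k]

theorem PIndependent.eq_zero_of_support_subset {Λ : Set k}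
    (hs : PIndependent p (Subtype.val : Λ → k)) {ι : Type*} (t : Finset ι) (a : ι → k →₀ ℕ)
    (ha : Set.InjOn a t) (hap : ∀ x ∈ t, ∀ i, a x i < p)
    (hsupp : ∀ x ∈ t, ∀ i ∈ (a x).support, i ∈ Λ) (c : ι → k)
    (h : ∑ x ∈ t, c x ^ p * ((a x).prod fun i e => i ^ e) = 0) : ∀ x ∈ t, c x = 0 := by
  refine hs.eq_zero t (fun x => (a x).subtypeDomain (· ∈ Λ)) ?_ (fun x hx i => hap x hx i) c ?_
  · intro x hx y hy hxy
    refine ha hx hy (Finsupp.ext fun i => ?_)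
    by_cases hi : i ∈ Λ
    · exact DFunLike.congr_fun hxy ⟨i, hi⟩
    · rw [Finsupp.notMem_support_iff.1 (mt (hsupp x hx i) hi),
        Finsupp.notMem_support_iff.1 (mt (hsupp y hy i) hi)]
  · rw [← h]
    refine Finset.sum_congr rfl fun x hx => ?_
    rw [Finsupp.prod_subtypeDomain_index (h := fun i e => i ^ e) (hsupp x hx)]

theorem pIndependent_empty [Fact p.Prime] : PIndependent p (Subtype.val : (∅ : Set k) → k) := by
  intro t c _ h a ha
  have : t = {a} := Finset.eq_singleton_iff_unique_mem.2 ⟨ha, fun b _ => Subsingleton.elim _ _⟩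
  subst this
  rw [Finset.sum_singleton, Subsingleton.elim a 0, Finsupp.prod_zero_index, mul_one] at h
  rw [Subsingleton.elim a 0]
  exact eq_zero_of_pow_eq_zero h

/-- Over `E`, the subfield generated by the `p`-th powers and `Λ`, the minimal polynomial of `x` is
`X ^ p - x ^ p`. Sorted by powers of `x`, a relation becomes a polynomial over `E` of degree below
`p` that vanishes at `x`, so each of its coefficients is a relation in `Λ`. -/
theorem PIndependent.insert_of_notMem [Fact p.Prime] [CharP k p] {Λ : Set k}
    (hs : PIndependent p (Subtype.val : Λ → k)) {x : k}
    (hx : x ∉ Subfield.closure (Set.range (fun y : k => y ^ p) ∪ Λ)) :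
    PIndependent p (Subtype.val : ↥(insert x Λ : Set k) → k) := by
  classical
  have : ExpChar k p := .prime Fact.out
  set E := Subfield.closure (Set.range (fun y : k => y ^ p) ∪ Λ) with hE
  have hpow : ∀ y : k, y ^ p ∈ E := fun y => Subfield.subset_closure (.inl ⟨y, rfl⟩)
  have hΛ : ∀ y ∈ Λ, y ∈ E := fun y hy => Subfield.subset_closure (.inr hy)
  have hxE : ∀ q : Polynomial E, q.degree < p → Polynomial.aeval x q = 0 → q = 0 := by
    intro q hq hq0
    by_contra hne
    have hirr : Irreducible (Polynomial.X ^ p - Polynomial.C (⟨x ^ p, hpow x⟩ : E)) :=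
      X_pow_sub_C_irreducible_of_prime Fact.out fun b hb => hx <| by
        have h1 : (b : k) ^ p = x ^ p := congr_arg Subtype.val hb
        rw [← frobenius_inj k p h1]
        exact b.2
    have hmin := minpoly.eq_of_irreducible_of_monic (x := x) hirr
      (by rw [map_sub, Polynomial.aeval_X_pow, Polynomial.aeval_C, sub_eq_zero]; rfl)
      (Polynomial.monic_X_pow_sub_C _ (Fact.out : p.Prime).ne_zero)
    have := minpoly.degree_le_of_ne_zero E x hne hq0
    rw [← hmin, Polynomial.degree_X_pow_sub_C (Fact.out : p.Prime).pos] at this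
    exact this.not_gt hq
  intro t c ht h
  -- The exponent vector with its `x`-coordinate removed.
  let b : (↥(insert x Λ : Set k) →₀ ℕ) → k →₀ ℕ :=
    fun a => (a.embDomain (Function.Embedding.subtype _)).erase x
  let x' : ↥(insert x Λ : Set k) := ⟨x, Set.mem_insert _ _⟩
  have hbapp : ∀ a (y : ↥(insert x Λ : Set k)), y.1 ≠ x → b a y.1 = a y := by
    intro a y hy
    simp only [b]
    rw [Finsupp.erase_ne hy]
    exact Finsupp.embDomain_apply_self (Function.Embedding.subtype _) a y
  have hbzero : ∀ a y, y ∉ Λ ∨ y = x → b a y = 0 := by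
    intro a y hy
    by_cases hyx : y = x
    · rw [hyx]; simp [b]
    · simp only [b]
      rw [Finsupp.erase_ne hyx, Finsupp.embDomain_of_notMem_range]
      rintro ⟨z, rfl⟩
      exact z.2.elim hyx (fun hz => hy.elim (fun h => h hz) hyx)
  have hbprod : ∀ a : ↥(insert x Λ : Set k) →₀ ℕ, (a.prod fun i e => i.1 ^ e) =
      x ^ a x' * (b a).prod fun i e => i ^ e := by
    intro a
    have h1 : (a.embDomain (Function.Embedding.subtype _)).prod (fun i e => i ^ e) =
        a.prod fun i e => i.1 ^ e := by
      rw [Finsupp.prod_embDomain]; rfl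
    rw [← h1, ← Finsupp.mul_prod_erase' _ x (fun i e => i ^ e) (fun i => pow_zero i)]
    congr 2
    exact Finsupp.embDomain_apply_self (Function.Embedding.subtype _) a x'
  have hcoef : ∀ j, ∑ a ∈ t.filter (fun a => a x' = j),
      c a ^ p * ((b a).prod fun i e => i ^ e) = 0 := by
    let e : ℕ → E := fun j => ⟨∑ a ∈ t.filter (fun a => a x' = j),
      c a ^ p * ((b a).prod fun i e => i ^ e), sum_mem fun a _ => mul_mem (hpow _) <|
        prod_mem fun i hi => pow_mem (hΛ i <| by
          by_contra hiΛ
          exact (Finsupp.mem_support_iff.1 hi) (hbzero a i (.inl hiΛ))) _⟩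
    let q : Polynomial E := ∑ j ∈ Finset.range p, Polynomial.monomial j (e j)
    have hq : q = 0 := by
      refine hxE q ?_ ?_
      · refine (Polynomial.degree_sum_le _ _).trans_lt ?_
        rw [Finset.sup_lt_iff (by exact WithBot.bot_lt_coe p)]
        intro j hj
        exact (Polynomial.degree_monomial_le _ _).trans_lt
          (by exact_mod_cast Finset.mem_range.1 hj)
      · rw [← h, map_sum]
        simp only [Polynomial.aeval_monomial]
        rw [← Finset.sum_fiberwise_of_maps_to (s := t) (t := Finset.range p) (g := fun a => a x')
          (fun a ha => Finset.mem_range.2 (ht a ha x'))]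
        refine Finset.sum_congr rfl fun j _ => ?_
        change (∑ a ∈ t.filter (fun a => a x' = j), c a ^ p * ((b a).prod fun i e => i ^ e)) *
          x ^ j = _
        rw [Finset.sum_mul]
        refine Finset.sum_congr rfl fun a ha => ?_
        rw [hbprod, (Finset.mem_filter.1 ha).2]
        ring
    intro j
    by_cases hj : j < p
    · have h1 := congr_arg (fun f => Polynomial.coeff f j) hq
      simp only [q, Polynomial.finsetSum_coeff, Polynomial.coeff_monomial, Finset.sum_ite_eq',
        Finset.mem_range, hj, if_true, Polynomial.coeff_zero] at h1
      exact congr_arg Subtype.val h1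
    · rw [Finset.filter_false_of_mem, Finset.sum_empty]
      rintro a ha rfl
      exact hj (ht a ha x')
  intro a ha
  refine hs.eq_zero_of_support_subset _ b ?_ ?_ ?_ c (hcoef (a x')) a (by simpa using ha)
  · intro a₁ h₁ a₂ h₂ h12
    simp only [Finset.coe_filter, Set.mem_ofPred_eq] at h₁ h₂
    ext y
    by_cases hy : y.1 = x
    · rw [show y = x' from Subtype.ext hy, h₁.2, h₂.2]
    · rw [← hbapp a₁ y hy, ← hbapp a₂ y hy, h12]
  · intro a' ha' i
    by_cases hi : i ∉ Λ ∨ i = x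
    · rw [hbzero _ _ hi]; exact (Fact.out : p.Prime).pos
    · push Not at hi
      rw [hbapp a' ⟨i, Set.mem_insert_of_mem _ hi.1⟩ hi.2]
      exact ht a' (Finset.mem_filter.1 ha').1 _
  · intro a' _ i hi
    by_contra hiΛ
    exact (Finsupp.mem_support_iff.1 hi) (hbzero a' i (.inl hiΛ))

/-- A relation involves finitely many elements, all of which lie in a single member of the chain. -/
theorem pIndependent_sUnion [Fact p.Prime] {S : Set (Set k)} (hS : IsChain (· ⊆ ·) S)
    (hne : S.Nonempty)
    (h : ∀ Λ ∈ S, PIndependent p (Subtype.val : Λ → k)) :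
    PIndependent p (Subtype.val : (⋃₀ S : Set k) → k) := by
  classical
  intro t c ht h0
  let b : ((⋃₀ S : Set k) →₀ ℕ) → k →₀ ℕ := fun a => a.embDomain (Function.Embedding.subtype _)
  obtain ⟨Λ, hΛS, hΛ⟩ := DirectedOn.exists_mem_subset_of_finset_subset_biUnion (f := id) hne
    hS.directedOn (s := t.biUnion fun a => (b a).support) (by
      intro i hi
      obtain ⟨a, _, ha⟩ := Finset.mem_biUnion.1 hi
      simp only [b, Finsupp.support_embDomain, Finset.mem_map] at ha
      obtain ⟨j, _, rfl⟩ := ha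
      simp only [id, ← Set.sUnion_eq_biUnion]
      exact j.2)
  refine (h Λ hΛS).eq_zero_of_support_subset t b ?_ ?_ ?_ c ?_
  · exact (Finsupp.embDomain_injective _).injOn
  · intro a ha i
    by_cases hi : i ∈ (⋃₀ S : Set k)
    · exact (Finsupp.embDomain_apply_self (Function.Embedding.subtype _) a ⟨i, hi⟩).trans_lt
        (ht a ha _)
    · rw [Finsupp.embDomain_of_notMem_range]
      · exact (Fact.out : p.Prime).pos
      · rintro ⟨j, rfl⟩
        exact hi j.2
  · intro a ha i hi
    exact hΛ (Finset.mem_biUnion.2 ⟨a, ha, hi⟩)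
  · rw [← h0]
    refine Finset.sum_congr rfl fun a _ => ?_
    rw [Finsupp.prod_embDomain]
    rfl

/-- Every `p`-independent set of a field of characteristic `p` is contained in a `p`-basis. -/
theorem PIndependent.exists_pBasis [Fact p.Prime] [CharP k p] {Λ₀ : Set k}
    (hs : PIndependent p (Subtype.val : Λ₀ → k)) :
    ∃ Λ : Set k, Λ₀ ⊆ Λ ∧ PIndependent p (Subtype.val : Λ → k) ∧
      Subfield.closure (Set.range (fun y : k => y ^ p) ∪ Λ) = ⊤ := by
  obtain ⟨Λ, hle, hmax⟩ := zorn_subset_nonempty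
    {Λ : Set k | PIndependent p (Subtype.val : Λ → k)}
    (fun S hSub hS hne => ⟨⋃₀ S, pIndependent_sUnion hS hne hSub,
      fun _ => Set.subset_sUnion_of_mem⟩) Λ₀ hs
  refine ⟨Λ, hle, hmax.prop, ?_⟩
  rw [eq_top_iff]
  rintro x -
  by_contra hx
  have h1 := hmax.le_of_ge (PIndependent.insert_of_notMem hmax.prop hx) (Set.subset_insert x Λ)
  exact hx (Subfield.subset_closure (.inr (h1 (Set.mem_insert x Λ))))

theorem pIndependent_singleton [Fact p.Prime] [CharP k p] {x : k} (hx : ∀ y, y ^ p ≠ x) :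
    PIndependent p (Subtype.val : ({x} : Set k) → k) := by
  have : ExpChar k p := .prime Fact.out
  rw [← insert_empty_eq]
  refine PIndependent.insert_of_notMem pIndependent_empty fun h => ?_
  have : Subfield.closure (Set.range (fun y : k => y ^ p) ∪ ∅) ≤ (frobenius k p).fieldRange := by
    rw [Subfield.closure_le, Set.union_empty]
    rintro _ ⟨y, rfl⟩
    exact ⟨y, rfl⟩
  obtain ⟨y, hy⟩ := this h
  exact hx y hy

end PBasis

/-! ### Divisibility by the uniformizer, flatness and separatedness. -/

section Reduction

variable {A : Type*} [CommRing A] [IsDomain A] [IsDiscreteValuationRing A]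
  {B : Type*} [CommRing B] [Algebra A B] {C : Type*} [CommRing C] [Algebra A C] {ϖ : A}

theorem maxIdeal_eq_span (hϖ : Irreducible ϖ) (B : Type*) [CommRing B] [Algebra A B] :
    maxIdeal A B = Ideal.span {algebraMap A B ϖ} := by
  rw [maxIdeal, hϖ.maximalIdeal_eq, Ideal.map_span, Set.image_singleton]

theorem mem_maxIdeal (hϖ : Irreducible ϖ) {b : B} : b ∈ maxIdeal A B ↔ algebraMap A B ϖ ∣ b := by
  rw [maxIdeal_eq_span hϖ, Ideal.mem_span_singleton]

theorem mem_maxIdeal_pow (hϖ : Irreducible ϖ) {b : B} {n : ℕ} :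
    b ∈ maxIdeal A B ^ n ↔ algebraMap A B ϖ ^ n ∣ b := by
  rw [maxIdeal_eq_span hϖ, Ideal.span_singleton_pow, Ideal.mem_span_singleton]

theorem mk_eq_zero_iff (hϖ : Irreducible ϖ) {b : B} :
    Ideal.Quotient.mk (maxIdeal A B) b = 0 ↔ algebraMap A B ϖ ∣ b := by
  rw [Ideal.Quotient.eq_zero_iff_mem, mem_maxIdeal hϖ]

theorem mk_eq_mk_iff (hϖ : Irreducible ϖ) {b c : B} :
    Ideal.Quotient.mk (maxIdeal A B) b = Ideal.Quotient.mk (maxIdeal A B) c ↔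
      algebraMap A B ϖ ∣ b - c := by
  rw [Ideal.Quotient.eq, mem_maxIdeal hϖ]

@[simp] theorem reductionMap_mk (f : B →ₐ[A] C) (b : B) :
    reductionMap f (Ideal.Quotient.mk _ b) = Ideal.Quotient.mk _ (f b) := rfl

/-- Flat means torsion-free here, and nonzero scalars are units times powers of `ϖ`. -/
theorem flat_iff (hϖ : Irreducible ϖ) :
    Module.Flat A B ↔ ∀ b : B, algebraMap A B ϖ * b = 0 → b = 0 := by
  rw [IsDedekindDomain.flat_iff_torsion_eq_bot, ← Submodule.isTorsionFree_iff_torsion_eq_bot,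
    Module.isTorsionFree_iff_smul_eq_zero]
  constructor
  · intro h b hb
    rw [← Algebra.smul_def] at hb
    exact (h ϖ b hb).resolve_left hϖ.ne_zero
  · intro h a b hab
    by_cases ha : a = 0
    · exact .inl ha
    · right
      obtain ⟨n, u, rfl⟩ := IsDiscreteValuationRing.eq_unit_mul_pow_irreducible ha hϖ
      rw [mul_smul, ← Units.smul_def, smul_eq_zero_iff_eq, Algebra.smul_def, map_pow] at hab
      induction n with
      | zero => simpa using hab
      | succ n ih =>
        rw [pow_succ', mul_assoc] at hab
        exact ih (h _ hab) (mul_ne_zero u.ne_zero (pow_ne_zero _ hϖ.ne_zero))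

theorem eq_zero_of_forall_pow_dvd [IsHausdorff (maxIdeal A B) B] {b : B}
    (hϖ : Irreducible ϖ) (h : ∀ n : ℕ, algebraMap A B ϖ ^ n ∣ b) : b = 0 := by
  refine IsHausdorff.haus' (I := maxIdeal A B) b fun n => ?_
  rw [SModEq.zero, smul_eq_mul, Ideal.mul_top, mem_maxIdeal_pow hϖ]
  exact h n

theorem bijective_pow_of_bijective {R S : Type*} [CommRing R] [CommRing S] {n : ℕ} (f : R →+* S)
    (hf : Function.Bijective f) (h : Function.Bijective fun x : R => x ^ n) :
    Function.Bijective fun x : S => x ^ n := by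
  have : (fun x : S => x ^ n) ∘ f = f ∘ fun x : R => x ^ n := by
    ext x
    simp
  rw [← Function.Bijective.of_comp_iff _ hf, this]
  exact hf.comp h

end Reduction

/-! ### Completion along the maximal ideal of `A`. -/

section Completion

variable (A : Type*) [CommRing A] [IsDomain A] [IsDiscreteValuationRing A]
  (D : Type*) [CommRing D] [Algebra A D] {ϖ : A}

/-- The completion of an `A`-algebra for the topology defined by the maximal ideal of `A`. -/
abbrev Completion := AdicCompletion (maxIdeal A D) D

/-- The canonical map to the completion. -/
noncomputable def toCompletion : D →ₐ[A] Completion A D :=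
  (Algebra.ofId D (Completion A D)).restrictScalars A

theorem maxIdeal_completion :
    maxIdeal A (Completion A D) = (maxIdeal A D).map (algebraMap D (Completion A D)) := by
  unfold maxIdeal
  rw [Ideal.map_map, ← IsScalarTower.algebraMap_eq]

theorem maxIdeal_fg : (maxIdeal A D).FG :=
  Ideal.FG.map (IsNoetherian.noetherian _) _

instance isAdicComplete_completion :
    IsAdicComplete (maxIdeal A (Completion A D)) (Completion A D) := by
  rw [maxIdeal_completion, IsAdicComplete.map_algebraMap_iff]
  exact AdicCompletion.isAdicComplete (maxIdeal_fg A D)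

theorem evalₐ_toCompletion (n : ℕ) (d : D) :
    AdicCompletion.evalₐ (maxIdeal A D) n (toCompletion A D d) = Ideal.Quotient.mk _ d :=
  (AdicCompletion.evalₐ (maxIdeal A D) n).commutes d

variable {A D}

theorem evalₐ_eq_zero_iff {x : Completion A D} {n : ℕ} :
    AdicCompletion.evalₐ (maxIdeal A D) n x = 0 ↔ x ∈ maxIdeal A (Completion A D) ^ n := by
  have h1 : AdicCompletion.evalₐ (maxIdeal A D) n x = 0 ↔
      AdicCompletion.eval (maxIdeal A D) D n x = 0 := by
    have eq : maxIdeal A D ^ n * ⊤ = maxIdeal A D ^ n := by simp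
    have : Function.Injective (Ideal.Quotient.factor ((le_of_eq eq))) := by
      simpa [RingHom.injective_iff_ker_eq_bot, Ideal.Quotient.factor_ker]
        using Ideal.map_mk_eq_bot_of_le (le_of_eq eq.symm)
    simpa [← AdicCompletion.factor_eval_eq_evalₐ] using map_eq_zero_iff _ this
  rw [h1, ← LinearMap.mem_ker, ← AdicCompletion.pow_smul_top_eq_ker_eval (maxIdeal_fg A D),
    maxIdeal_completion, ← Ideal.map_pow (algebraMap D _), Ideal.smul_top_eq_map]
  rfl

theorem exists_toCompletion_sub_mem (x : Completion A D) (n : ℕ) :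
    ∃ d, x - toCompletion A D d ∈ maxIdeal A (Completion A D) ^ n := by
  obtain ⟨d, hd⟩ := Ideal.Quotient.mk_surjective (AdicCompletion.evalₐ (maxIdeal A D) n x)
  refine ⟨d, ?_⟩
  rw [← evalₐ_eq_zero_iff, map_sub, evalₐ_toCompletion, hd, sub_self]

theorem toCompletion_mem_iff {d : D} {n : ℕ} :
    toCompletion A D d ∈ maxIdeal A (Completion A D) ^ n ↔ d ∈ maxIdeal A D ^ n := by
  rw [← evalₐ_eq_zero_iff, evalₐ_toCompletion, Ideal.Quotient.eq_zero_iff_mem]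

variable (A D) in
theorem reductionMap_toCompletion_bijective :
    Function.Bijective (reductionMap (toCompletion A D)) := by
  constructor
  · rw [injective_iff_map_eq_zero]
    intro x hx
    obtain ⟨d, rfl⟩ := Ideal.Quotient.mk_surjective x
    rw [reductionMap_mk, Ideal.Quotient.eq_zero_iff_mem] at hx
    rw [Ideal.Quotient.eq_zero_iff_mem]
    have h := (toCompletion_mem_iff (A := A) (d := d) (n := 1)).1
      ((pow_one (maxIdeal A (Completion A D))).symm ▸ hx)
    rwa [pow_one] at h
  · intro y
    obtain ⟨y, rfl⟩ := Ideal.Quotient.mk_surjective y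
    obtain ⟨d, hd⟩ := exists_toCompletion_sub_mem y 1
    refine ⟨Ideal.Quotient.mk _ d, ?_⟩
    rw [reductionMap_mk, eq_comm, Ideal.Quotient.eq]
    simpa using hd

theorem flat_completion [Module.Flat A D] : Module.Flat A (Completion A D) := by
  obtain ⟨ϖ, hϖ⟩ := IsDiscreteValuationRing.exists_irreducible A
  have hD := (flat_iff hϖ).1 ‹Module.Flat A D›
  rw [flat_iff hϖ]
  intro x hx
  refine eq_zero_of_forall_pow_dvd hϖ fun n => ?_
  -- Approximation to order `n + 1`, because cancelling `ϖ` in `D` loses one power.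
  obtain ⟨d, hd⟩ := exists_toCompletion_sub_mem x (n + 1)
  rw [← mem_maxIdeal_pow hϖ]
  have h1 : toCompletion A D (algebraMap A D ϖ * d) ∈ maxIdeal A (Completion A D) ^ (n + 1) := by
    rw [map_mul, AlgHom.commutes]
    have := Ideal.mul_mem_left _ (algebraMap A _ ϖ) hd
    rw [mul_sub, hx, zero_sub, neg_mem_iff] at this
    exact this
  rw [toCompletion_mem_iff, mem_maxIdeal_pow hϖ, pow_succ', ] at h1
  obtain ⟨e, he⟩ := h1
  have h2 : d = algebraMap A D ϖ ^ n * e := by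
    rw [← sub_eq_zero]
    refine hD _ ?_
    rw [mul_sub, he]
    ring
  rw [← sub_add_cancel x (toCompletion A D d)]
  refine add_mem (Ideal.pow_le_pow_right n.le_succ hd) ?_
  rw [toCompletion_mem_iff, mem_maxIdeal_pow hϖ, h2]
  exact dvd_mul_right _ _

theorem isCompleteResidualPerfection_completion {p : ℕ} [Module.Flat A D]
    (h : Function.Bijective fun x : Reduction A D => x ^ p) :
    IsCompleteResidualPerfection p A (Completion A D) where
  flat := flat_completion
  complete := inferInstance
  perfect := bijective_pow_of_bijective _ (reductionMap_toCompletion_bijective A D) h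

variable {C : Type*} [CommRing C] [Algebra A C]

theorem map_mem_maxIdeal_pow {B : Type*} [CommRing B] [Algebra A B] (f : B →ₐ[A] C) {n : ℕ} {b : B}
    (hb : b ∈ maxIdeal A B ^ n) : f b ∈ maxIdeal A C ^ n := by
  obtain ⟨ϖ, hϖ⟩ := IsDiscreteValuationRing.exists_irreducible A
  rw [mem_maxIdeal_pow hϖ] at hb ⊢
  simpa using map_dvd f hb

theorem completion_algHom_ext [IsHausdorff (maxIdeal A C) C] {f g : Completion A D →ₐ[A] C}
    (h : ∀ d, f (toCompletion A D d) = g (toCompletion A D d)) : f = g := by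
  ext x
  rw [← sub_eq_zero]
  refine IsHausdorff.haus' (I := maxIdeal A C) _ fun n => ?_
  rw [SModEq.zero, smul_eq_mul, Ideal.mul_top]
  obtain ⟨d, hd⟩ := exists_toCompletion_sub_mem x n
  have := sub_mem (map_mem_maxIdeal_pow f hd) (map_mem_maxIdeal_pow g hd)
  rw [map_sub, map_sub, h] at this
  simpa using this

theorem exists_completion_lift [IsAdicComplete (maxIdeal A C) C] (f : D →ₐ[A] C) :
    ∃ g : Completion A D →ₐ[A] C, ∀ d, g (toCompletion A D d) = f d := by
  let G (n : ℕ) : D ⧸ maxIdeal A D ^ n →ₐ[A] C ⧸ maxIdeal A C ^ n :=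
    Ideal.quotientMapₐ (maxIdeal A C ^ n) f fun _ hb => map_mem_maxIdeal_pow f hb
  let F (n : ℕ) : Completion A D →ₐ[A] C ⧸ maxIdeal A C ^ n :=
    (G n).comp ((AdicCompletion.evalₐ (maxIdeal A D) n).restrictScalars A)
  have hF0 : ∀ n x, F n x = G n (AdicCompletion.evalₐ (maxIdeal A D) n x) := fun _ _ => rfl
  have hF : ∀ n d, F n (toCompletion A D d) = Ideal.Quotient.mk _ (f d) := by
    intro n d
    rw [hF0, evalₐ_toCompletion]
    rfl
  have hF' : ∀ n x, x ∈ maxIdeal A (Completion A D) ^ n → F n x = 0 := by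
    intro n x hx
    rw [hF0, evalₐ_eq_zero_iff.2 hx, map_zero]
  refine ⟨IsAdicComplete.liftAlgHom (maxIdeal A C) F ?_, ?_⟩
  · intro m n hmn
    ext x
    obtain ⟨d, hd⟩ := exists_toCompletion_sub_mem x n
    have hn : F n x = F n (toCompletion A D d) := by
      rw [← sub_eq_zero, ← map_sub, hF' n _ hd]
    have hm : F m x = F m (toCompletion A D d) := by
      rw [← sub_eq_zero, ← map_sub, hF' m _ (Ideal.pow_le_pow_right hmn hd)]
    rw [AlgHom.comp_apply, hn, hm, hF, hF]
    rfl
  · intro d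
    rw [← sub_eq_zero]
    refine IsHausdorff.haus' (I := maxIdeal A C) _ fun n => ?_
    rw [SModEq.zero, smul_eq_mul, Ideal.mul_top]
    refine Ideal.Quotient.eq.1 (?_ : Ideal.Quotient.mk (maxIdeal A C ^ n) _ = _)
    rw [← hF]
    exact IsAdicComplete.mk_liftAlgHom _ _ _ _ _

end Completion

/-! ### Existence and uniqueness of compatible `p`-power roots. -/

section Teichmuller

variable {p : ℕ} [Fact p.Prime] {A : Type*} [CommRing A] [IsDomain A] [IsDiscreteValuationRing A]
  [CharP (IsLocalRing.ResidueField A) p] {ϖ : A}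
  {C : Type*} [CommRing C] [Algebra A C]

omit [Fact p.Prime] in
theorem natCast_mem_maximalIdeal : (p : A) ∈ IsLocalRing.maximalIdeal A := by
  rw [← IsLocalRing.residue_eq_zero_iff, map_natCast, CharP.cast_eq_zero]

omit [Fact p.Prime] in
theorem natCast_mem_maxIdeal : (p : C) ∈ maxIdeal A C := by
  have := Ideal.mem_map_of_mem (algebraMap A C) (natCast_mem_maximalIdeal (p := p) (A := A))
  rwa [map_natCast] at this

theorem charP_reduction [Nontrivial (Reduction A C)] : CharP (Reduction A C) p := by
  rw [CharP.charP_iff_prime_eq_zero Fact.out]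
  have := Ideal.Quotient.eq_zero_iff_mem.2 (natCast_mem_maxIdeal (p := p) (A := A) (C := C))
  rwa [map_natCast] at this

/-- Every residue class has a lift with compatible `p`-power roots. -/
theorem IsCompleteResidualPerfection.exists_compatible (hC : IsCompleteResidualPerfection p A C)
    (c : C) : ∃ r : ℕ → C, (∀ n, r (n + 1) ^ p = r n) ∧ r 0 - c ∈ maxIdeal A C := by
  have := hC.complete
  rcases subsingleton_or_nontrivial (Reduction A C) with h | h
  · have htop : maxIdeal A C = ⊤ := Ideal.Quotient.subsingleton_iff.1 h
    exact ⟨0, fun n => by simp [(Fact.out : p.Prime).ne_zero], by rw [htop]; trivial⟩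
  have := charP_reduction (p := p) (A := A) (C := C)
  obtain ⟨g, hg⟩ := hC.perfect.2.hasRightInverse
  let x : Perfection (Reduction A C) p := ⟨fun n => g^[n] (Ideal.Quotient.mk _ c), fun n => by
    simp only [Function.iterate_succ_apply']
    exact hg _⟩
  -- Compatible root sequences modulo the ideal lift to `C` by completeness; `x` consists of
  -- iterated `p`-th roots of the residue of `c`.
  let y := (Perfection.quotientMulEquiv p (maxIdeal A C)).symm x
  refine ⟨fun n => y.1 n, fun n => y.2 n, ?_⟩
  have h1 : Perfection.quotientMulEquiv p (maxIdeal A C) y = x := by simp [y]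
  have h2 := congr_arg (Perfection.coeff _ p 0) h1
  rw [Perfection.coeff_quotientMulEquiv] at h2
  exact Ideal.Quotient.eq.1 h2

-- Injectivity of Frobenius propagates the congruence to every level. The `n`-th terms are `p ^
-- m`-th powers of congruent elements, hence congruent modulo arbitrarily high powers of the ideal,
-- which contains `p`.
omit [Fact p.Prime] in
theorem compatible_ext [IsHausdorff (maxIdeal A C) C]
    (hC : Function.Injective fun x : Reduction A C => x ^ p) {r r' : ℕ → C}
    (hr : ∀ n, r (n + 1) ^ p = r n) (hr' : ∀ n, r' (n + 1) ^ p = r' n)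
    (h : r 0 - r' 0 ∈ maxIdeal A C) : r = r' := by
  have hmk : ∀ n, Ideal.Quotient.mk (maxIdeal A C) (r n) = Ideal.Quotient.mk _ (r' n) := by
    intro n
    induction n with
    | zero => exact Ideal.Quotient.eq.2 h
    | succ n ih =>
      refine hC ?_
      change _ ^ p = _ ^ p
      rw [← map_pow, ← map_pow, hr, hr', ih]
  ext n
  rw [← sub_eq_zero]
  refine IsHausdorff.haus' (I := maxIdeal A C) _ fun m => ?_
  rw [SModEq.zero, smul_eq_mul, Ideal.mul_top, ← pow_pow_of_compatible hr n m,
    ← pow_pow_of_compatible hr' n m]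
  have h1 : r (n + m) ≡ r' (n + m) [SMOD maxIdeal A C] :=
    SModEq.sub_mem.2 (Ideal.Quotient.eq.1 (hmk _))
  exact Ideal.pow_le_pow_right m.le_succ
    (SModEq.sub_mem.1 (h1.pow_pow_add_one (natCast_mem_maxIdeal (p := p)) (m := m)))

end Teichmuller

/-! ### The model: generic digit expansions of the elements `T l`. -/

section Model

variable {Λ : Type*} {A : Type*} [CommRing A]

/-- The elements `T_l - ϖ X_{l,0}` and `X_{l,j} - ϖ X_{l,j+1}`. -/
noncomputable def digitFamily (ϖ : A) (T : Λ → A) : Λ ⊕ (Λ × ℕ) → MvPolynomial (Λ × ℕ) A :=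
  Sum.elim (fun l => MvPolynomial.C (T l) - MvPolynomial.C ϖ * MvPolynomial.X (l, 0))
    (fun x => MvPolynomial.X x - MvPolynomial.C ϖ * MvPolynomial.X (x.1, x.2 + 1))

/-- The `A`-algebra obtained from `A[X_{l,j}]` by adjoining all `p`-power roots of the elements
`T_l - ϖ X_{l,0}` and `X_{l,j} - ϖ X_{l,j+1}`. -/
def Model (p : ℕ) (ϖ : A) (T : Λ → A) := RootRing p (digitFamily ϖ T)

variable (p : ℕ) (ϖ : A) (T : Λ → A)

noncomputable instance : CommRing (Model p ϖ T) :=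
  inferInstanceAs (CommRing (RootRing p (digitFamily ϖ T)))

/-- The inclusion of the polynomial ring. -/
noncomputable def modelOf : MvPolynomial (Λ × ℕ) A →+* Model p ϖ T :=
  algebraMap _ (RootRing p (digitFamily ϖ T))

noncomputable instance : Algebra A (Model p ϖ T) :=
  ((modelOf p ϖ T).comp MvPolynomial.C).toAlgebra

theorem algebraMap_model (a : A) :
    algebraMap A (Model p ϖ T) a = modelOf p ϖ T (MvPolynomial.C a) := rfl

variable [Fact p.Prime]

/-- The adjoined roots. -/
noncomputable def modelRoot (i : Λ ⊕ (Λ × ℕ)) (n : ℕ) : Model p ϖ T :=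
  sroot p (digitFamily ϖ T) i n

theorem modelRoot_succ_pow (i : Λ ⊕ (Λ × ℕ)) (n : ℕ) :
    modelRoot p ϖ T i (n + 1) ^ p = modelRoot p ϖ T i n := sroot_succ_pow _ _ _ _

theorem modelRoot_inl_zero (l : Λ) : modelRoot p ϖ T (.inl l) 0 =
    algebraMap A _ (T l) - algebraMap A _ ϖ * modelOf p ϖ T (MvPolynomial.X (l, 0)) := by
  rw [algebraMap_model, algebraMap_model, ← map_mul, ← map_sub]
  exact sroot_zero p _ _

theorem modelRoot_inr_zero (x : Λ × ℕ) : modelRoot p ϖ T (.inr x) 0 =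
    modelOf p ϖ T (MvPolynomial.X x) -
      algebraMap A _ ϖ * modelOf p ϖ T (MvPolynomial.X (x.1, x.2 + 1)) := by
  rw [algebraMap_model, ← map_mul, ← map_sub]
  exact sroot_zero p _ _

variable {p ϖ T}

theorem Model.algHom_ext {C : Type*} [CommRing C] [Algebra A C] {f g : Model p ϖ T →ₐ[A] C}
    (h : ∀ x, f (modelOf p ϖ T (MvPolynomial.X x)) = g (modelOf p ϖ T (MvPolynomial.X x)))
    (h' : ∀ i n, f (modelRoot p ϖ T i n) = g (modelRoot p ϖ T i n)) : f = g := by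
  have h1 : (f : Model p ϖ T →+* C).comp (modelOf p ϖ T) =
      (g : Model p ϖ T →+* C).comp (modelOf p ϖ T) := by
    refine MvPolynomial.ringHom_ext (fun a => ?_) h
    exact (f.commutes a).trans (g.commutes a).symm
  have h2 : (f : Model p ϖ T →+* C) = g :=
    RootRing.ringHom_ext p (digitFamily ϖ T) (DFunLike.congr_fun h1) h'
  ext x
  exact DFunLike.congr_fun h2 x

variable [IsDomain A] [IsDiscreteValuationRing A]

omit [Fact p.Prime] in
theorem Model.flat (hϖ : Irreducible ϖ) : Module.Flat A (Model p ϖ T) := by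
  rw [flat_iff hϖ]
  intro d hd
  exact RootRing.eq_zero_of_mul_eq_zero (x := MvPolynomial.C ϖ)
    (by rw [Ne, MvPolynomial.C_eq_zero]; exact hϖ.ne_zero) hd

variable [CharP (IsLocalRing.ResidueField A) p]

/-- Every complete residual perfection receives exactly one map from the model. -/
theorem Model.existsUnique_algHom (hϖ : Irreducible ϖ)
    {C : Type*} [CommRing C] [Algebra A C]
    (hC : IsCompleteResidualPerfection p A C) : ∃! _f : Model p ϖ T →ₐ[A] C, True := by
  have := hC.complete
  have hreg := (flat_iff hϖ).1 hC.flat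
  choose r hr hr0 using hC.exists_compatible
  have hdig : ∀ c : C, ∃ d, c = r c 0 + algebraMap A C ϖ * d := by
    intro c
    obtain ⟨d, hd⟩ := (mem_maxIdeal hϖ).1 (hr0 c)
    exact ⟨-d, by rw [mul_neg, ← hd]; ring⟩
  choose dig hdig using hdig
  -- The remainder of `T l` after `n` digits.
  let t : Λ → ℕ → C := fun l n => dig^[n] (algebraMap A C (T l))
  have ht : ∀ l n, t l n = r (t l n) 0 + algebraMap A C ϖ * t l (n + 1) := by
    intro l n
    simp only [t]
    rw [Function.iterate_succ_apply']
    exact hdig _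
  -- The shift by one occurs because the zeroth remainder is `T l` itself and has no variable.
  let F : MvPolynomial (Λ × ℕ) A →ₐ[A] C := MvPolynomial.aeval fun x => t x.1 (x.2 + 1)
  obtain ⟨G, hG1, hG2⟩ := RootRing.exists_lift p (digitFamily ϖ T) (F : _ →+* C)
    (Sum.elim (fun l => r (t l 0)) fun x => r (t x.1 (x.2 + 1))) (by
      rintro (l | x)
      · have := ht l 0
        simp only [digitFamily, Sum.elim_inl, RingHom.coe_coe, map_sub, map_mul,
          MvPolynomial.algHom_C, F, MvPolynomial.aeval_X]
        exact eq_sub_of_add_eq this.symm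
      · have := ht x.1 (x.2 + 1)
        simp only [digitFamily, Sum.elim_inr, RingHom.coe_coe, map_sub, map_mul,
          MvPolynomial.algHom_C, F, MvPolynomial.aeval_X]
        exact eq_sub_of_add_eq this.symm) (by rintro (l | x) n <;> exact hr _ _)
  let G' : Model p ϖ T →ₐ[A] C := { G with
    commutes' := fun a => (hG1 _).trans (by simp) }
  refine ⟨G', trivial, fun f _ => ?_⟩
  -- Two maps that agree on a digit modulo `ϖ` agree on all of its roots.
  have key : ∀ (g g' : Model p ϖ T →ₐ[A] C) (i : Λ ⊕ (Λ × ℕ)),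
      g (modelRoot p ϖ T i 0) - g' (modelRoot p ϖ T i 0) ∈ maxIdeal A C →
      ∀ n, g (modelRoot p ϖ T i n) = g' (modelRoot p ϖ T i n) := by
    intro g g' i hi n
    exact congr_fun (compatible_ext hC.perfect.1 (r := fun n => g (modelRoot p ϖ T i n))
      (r' := fun n => g' (modelRoot p ϖ T i n))
      (fun n => by rw [← map_pow, modelRoot_succ_pow])
      (fun n => by rw [← map_pow, modelRoot_succ_pow]) hi) n
  have cancel : ∀ x y : C, algebraMap A C ϖ * x = algebraMap A C ϖ * y → x = y := by
    intro x y h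
    rw [← sub_eq_zero]
    exact hreg _ (by rw [mul_sub, h, sub_self])
  have hinl : ∀ l n, f (modelRoot p ϖ T (.inl l) n) = G' (modelRoot p ϖ T (.inl l) n) := by
    intro l
    refine key _ _ _ ?_
    rw [modelRoot_inl_zero, map_sub, map_sub, map_mul, map_mul, AlgHom.commutes, AlgHom.commutes,
      AlgHom.commutes, AlgHom.commutes, sub_sub_sub_cancel_left, ← mul_sub, mem_maxIdeal hϖ]
    exact dvd_mul_right _ _
  have hinr : ∀ x, f (modelOf p ϖ T (MvPolynomial.X x)) = G' (modelOf p ϖ T (MvPolynomial.X x)) →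
      ∀ n, f (modelRoot p ϖ T (.inr x) n) = G' (modelRoot p ϖ T (.inr x) n) := by
    intro x hx
    refine key _ _ _ ?_
    rw [modelRoot_inr_zero, map_sub, map_sub, map_mul, map_mul, AlgHom.commutes, AlgHom.commutes,
      hx, sub_sub_sub_cancel_left, ← mul_sub, mem_maxIdeal hϖ]
    exact dvd_mul_right _ _
  -- A digit is known modulo `ϖ` from the current remainder, hence exactly; cancelling `ϖ` then
  -- determines the next remainder.
  have hX : ∀ l n, f (modelOf p ϖ T (MvPolynomial.X (l, n))) =
      G' (modelOf p ϖ T (MvPolynomial.X (l, n))) := by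
    intro l n
    induction n with
    | zero =>
      have h := hinl l 0
      rw [modelRoot_inl_zero, map_sub, map_sub, map_mul, map_mul, AlgHom.commutes,
        AlgHom.commutes, AlgHom.commutes, AlgHom.commutes] at h
      exact cancel _ _ (sub_right_injective h)
    | succ n ih =>
      have h := hinr _ ih 0
      rw [modelRoot_inr_zero, map_sub, map_sub, map_mul, map_mul, AlgHom.commutes,
        AlgHom.commutes, ih] at h
      exact cancel _ _ (sub_right_injective h)
  refine Model.algHom_ext (fun x => hX _ _) ?_
  rintro (l | x)
  · exact hinl l
  · exact hinr x (hX _ _)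

end Model

/-! ### The perfection of `k[X]` as a root ring. -/

section ResidueFamily

variable {Λ : Type*} {k : Type*} [Field k]

/-- The family consisting of the constants `t l` and of all variables of `k[X_{l,j}]`. -/
noncomputable def residueFamily (t : Λ → k) : Λ ⊕ (Λ × ℕ) → MvPolynomial (Λ × ℕ) k :=
  Sum.elim (fun l => MvPolynomial.C (t l)) MvPolynomial.X

variable {p : ℕ} [Fact p.Prime] [CharP k p] {t : Λ → k}

theorem rootRing_residueFamily_isDomain (ht : PIndependent p t) :
    IsDomain (RootRing p (residueFamily t)) :=
  RootRing.isDomain ht.sumElim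

/-- For surjectivity, the image of Frobenius is a subring containing all the roots. It contains `k`,
which is generated by its `p`-th powers and the `t l`, and hence contains everything. -/
theorem rootRing_residueFamily_bijective (ht : PIndependent p t)
    (ht' : Subfield.closure (Set.range (fun y : k => y ^ p) ∪ Set.range t) = ⊤) :
    Function.Bijective fun x : RootRing p (residueFamily t) => x ^ p := by
  refine ⟨RootRing.frobenius_injective ht.sumElim, ?_⟩
  have : CharP (RootRing p (residueFamily t)) p :=
    charP_of_injective_algebraMap RootRing.algebraMap_injective p
  have : ExpChar (RootRing p (residueFamily t)) p := .prime Fact.out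
  let S := (frobenius (RootRing p (residueFamily t)) p).range
  have hroot : ∀ i n, sroot p (residueFamily t) i n ∈ S := fun i n =>
    ⟨_, sroot_succ_pow p (residueFamily t) i n⟩
  have hs : ∀ i, algebraMap _ (RootRing p (residueFamily t)) (residueFamily t i) ∈ S := fun i => by
    rw [← sroot_zero]
    exact hroot i 0
  let c : k →+* RootRing p (residueFamily t) :=
    (algebraMap (MvPolynomial (Λ × ℕ) k) _).comp MvPolynomial.C
  have hk : ∀ x, c x ∈ S := by
    intro x
    have hx : x ∈ Subfield.closure (Set.range (fun y : k => y ^ p) ∪ Set.range t) := by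
      rw [ht']; trivial
    induction hx using Subfield.closure_induction with
    | mem x hx =>
      obtain ⟨y, rfl⟩ | ⟨l, rfl⟩ := hx
      · exact ⟨c y, (map_pow c y p).symm⟩
      · exact hs (.inl l)
    | one => rw [map_one]; exact one_mem _
    | add x y _ _ hx hy => rw [map_add]; exact add_mem hx hy
    | neg x _ hx => rw [map_neg]; exact neg_mem hx
    | inv x _ hx =>
      -- The image of Frobenius is not a field; this identity gives its closure under inverses of
      -- elements of `k`.
      have : x⁻¹ = (x⁻¹) ^ p * x ^ (p - 1) := by
        by_cases h0 : x = 0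
        · simp [h0, (Fact.out : p.Prime).ne_zero]
        · obtain ⟨n, hn⟩ := Nat.exists_eq_succ_of_ne_zero (Fact.out : p.Prime).ne_zero
          rw [hn, Nat.succ_sub_one, pow_succ', mul_assoc, ← mul_pow, inv_mul_cancel₀ h0, one_pow,
            mul_one]
      rw [this, map_mul, map_pow, map_pow]
      exact mul_mem ⟨c x⁻¹, rfl⟩ (pow_mem hx _)
    | mul x y _ _ hx hy => rw [map_mul]; exact mul_mem hx hy
  have hpoly : ∀ f : MvPolynomial (Λ × ℕ) k,
      algebraMap _ (RootRing p (residueFamily t)) f ∈ S := by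
    intro f
    induction f using MvPolynomial.induction_on with
    | C a => exact hk a
    | add f g hf hg => rw [map_add]; exact add_mem hf hg
    | mul_X f x hf => rw [map_mul]; exact mul_mem hf (hs (.inr x))
  intro y
  have hy : y ∈ Algebra.adjoin (MvPolynomial (Λ × ℕ) k)
      (Set.range fun x : _ × ℕ => sroot p (residueFamily t) x.1 x.2) := by
    rw [adjoin_sroot]; trivial
  have : y ∈ S := by
    induction hy using Algebra.adjoin_induction with
    | mem x hx => obtain ⟨x, rfl⟩ := hx; exact hroot _ _
    | algebraMap r => exact hpoly r
    | add x y _ _ hx hy => exact add_mem hx hy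
    | mul x y _ _ hx hy => exact mul_mem hx hy
  exact this

end ResidueFamily

/-! ### The reduction of the model, and its completion. -/

section ModelReduction

open IsLocalRing

variable {Λ : Type*} {A : Type*} [CommRing A] [IsDomain A] [IsDiscreteValuationRing A]
  {p : ℕ} [Fact p.Prime] {ϖ : A} (T : Λ → A)

/-- Modulo `ϖ` the elements `T l - ϖ X` and `X - ϖ X'` become `t l` and `X`. The kernel of the base
change along `A[X] → k[X]` is read off coordinatewise. -/
theorem exists_reductionEquiv (hϖ : Irreducible ϖ) :
    ∃ e : Reduction A (Model p ϖ T) ≃+* RootRing p (residueFamily fun l => residue A (T l)),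
      ∀ f, e (Ideal.Quotient.mk _ (modelOf p ϖ T f)) =
        algebraMap _ _ (MvPolynomial.map (residue A) f) := by
  let φ : MvPolynomial (Λ × ℕ) A →+* MvPolynomial (Λ × ℕ) (ResidueField A) :=
    MvPolynomial.map (residue A)
  have hϖ0 : residue A ϖ = 0 := by
    rw [residue_eq_zero_iff, hϖ.maximalIdeal_eq]
    exact Ideal.mem_span_singleton_self ϖ
  have hs : (fun i => φ (digitFamily ϖ T i)) = residueFamily fun l => residue A (T l) := by
    funext i
    rcases i with l | x <;> simp [φ, digitFamily, residueFamily, hϖ0]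
  have h : ∃ Φ : Model p ϖ T →+* RootRing p (fun i => φ (digitFamily ϖ T i)),
      Function.Surjective Φ ∧ (∀ d, Φ d = 0 → algebraMap A _ ϖ ∣ d) ∧
        ∀ f, Φ (modelOf p ϖ T f) = algebraMap _ _ (φ f) := by
    obtain ⟨Φ, h1, h2⟩ := RootRing.exists_baseChange (p := p) φ (digitFamily ϖ T)
    refine ⟨Φ, RootRing.baseChange_surjective h1 h2
      (MvPolynomial.map_surjective _ residue_surjective), fun d hd => ?_, h1⟩
    refine RootRing.dvd_of_baseChange_eq_zero h1 h2 (ϖ := MvPolynomial.C ϖ) (fun f hf => ?_) hd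
    rw [MvPolynomial.C_dvd_iff_dvd_coeff]
    intro m
    have := congr_arg (MvPolynomial.coeff m) hf
    rw [MvPolynomial.coeff_map, MvPolynomial.coeff_zero, residue_eq_zero_iff,
      hϖ.maximalIdeal_eq, Ideal.mem_span_singleton] at this
    exact this
  rw [hs] at h
  obtain ⟨Φ, hsurj, hker, hΦ⟩ := h
  have hle : ∀ d ∈ maxIdeal A (Model p ϖ T), Φ d = 0 := by
    intro d hd
    obtain ⟨d, rfl⟩ := (mem_maxIdeal hϖ).1 hd
    rw [map_mul, algebraMap_model, hΦ, MvPolynomial.map_C, hϖ0, map_zero, map_zero, zero_mul]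
  refine ⟨RingEquiv.ofBijective (Ideal.Quotient.lift _ Φ hle) ⟨?_, ?_⟩, fun f => hΦ f⟩
  · rw [injective_iff_map_eq_zero]
    intro x hx
    obtain ⟨d, rfl⟩ := Ideal.Quotient.mk_surjective x
    rw [mk_eq_zero_iff hϖ]
    exact hker d hx
  · intro y
    obtain ⟨d, rfl⟩ := hsurj y
    exact ⟨Ideal.Quotient.mk _ d, rfl⟩

variable [CharP (ResidueField A) p]

/-- The elements `T l` lift the elements of a `p`-basis of the residue field. -/
structure LiftsPBasis (p : ℕ) (T : Λ → A) : Prop where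
  pIndependent : PIndependent p fun l => residue A (T l)
  closure_eq_top : Subfield.closure
    (Set.range (fun y : ResidueField A => y ^ p) ∪ Set.range fun l => residue A (T l)) = ⊤

variable {T}

theorem LiftsPBasis.isDomain (hT : LiftsPBasis p T) (hϖ : Irreducible ϖ) :
    IsDomain (Reduction A (Model p ϖ T)) := by
  obtain ⟨e, -⟩ := exists_reductionEquiv (p := p) T hϖ
  have := rootRing_residueFamily_isDomain hT.pIndependent
  exact e.toMulEquiv.isDomain _

theorem LiftsPBasis.perfect (hT : LiftsPBasis p T) (hϖ : Irreducible ϖ) :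
    Function.Bijective fun x : Reduction A (Model p ϖ T) => x ^ p := by
  obtain ⟨e, -⟩ := exists_reductionEquiv (p := p) T hϖ
  exact bijective_pow_of_bijective (e.symm : _ →+* _) e.symm.bijective
    (rootRing_residueFamily_bijective hT.pIndependent hT.closure_eq_top)

/-- The completion of the model is a complete residual perfection. -/
theorem LiftsPBasis.isCompleteResidualPerfection (hT : LiftsPBasis p T) (hϖ : Irreducible ϖ) :
    IsCompleteResidualPerfection p A (Completion A (Model p ϖ T)) :=
  have := Model.flat (p := p) (T := T) hϖ
  isCompleteResidualPerfection_completion (hT.perfect hϖ)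

theorem existsUnique_algHom_completion_model (hϖ : Irreducible ϖ) (T : Λ → A)
    {C : Type*} [CommRing C] [Algebra A C] (hC : IsCompleteResidualPerfection p A C) :
    Nonempty (Unique (Completion A (Model p ϖ T) →ₐ[A] C)) := by
  have := hC.complete
  obtain ⟨f, -, hf⟩ := Model.existsUnique_algHom (p := p) (T := T) hϖ hC
  obtain ⟨g, hg⟩ := exists_completion_lift f
  refine ⟨⟨⟨g⟩, fun g' => completion_algHom_ext fun d => ?_⟩⟩
  have h1 := hf (g'.comp (toCompletion A _)) trivial
  exact (DFunLike.congr_fun h1 d).trans (hg d).symm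

end ModelReduction

/-! ### Lifting `p`-bases, and the universal residual perfection. -/

section Existence

open IsLocalRing

variable {A : Type u} [CommRing A] [IsDomain A] [IsDiscreteValuationRing A]
  {p : ℕ} [Fact p.Prime] [CharP (ResidueField A) p]

/-- Prescribing the lifts in `S` later allows a chosen element of `A` to be one of the `T l`. -/
theorem exists_liftsPBasis_of_pIndependent {S : Set A}
    (hS : Set.InjOn (residue A) S)
    (h : PIndependent p (Subtype.val : ↥(residue A '' S) → ResidueField A)) :
    ∃ (Λ : Type u) (T : Λ → A), LiftsPBasis p T ∧ S ⊆ Set.range T := by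
  classical
  obtain ⟨Λ, hle, hind, hcl⟩ := h.exists_pBasis
  have hlift : ∀ l : Λ, ∃ a : A, residue A a = l ∧ ∀ b ∈ S, residue A b = l → a = b := by
    intro l
    by_cases hl : l.1 ∈ residue A '' S
    · obtain ⟨a, ha, hal⟩ := hl
      exact ⟨a, hal, fun b hb hbl => hS ha hb (hal.trans hbl.symm)⟩
    · obtain ⟨a, ha⟩ := residue_surjective l.1
      exact ⟨a, ha, fun b hb hbl => (hl ⟨b, hb, hbl⟩).elim⟩
  choose T hT hT' using hlift
  have hval : (fun l => residue A (T l)) = Subtype.val := funext hT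
  refine ⟨Λ, T, ⟨?_, ?_⟩, fun a ha => ⟨⟨residue A a, hle ⟨a, ha, rfl⟩⟩, hT' _ a ha rfl⟩⟩
  · rw [hval]; exact hind
  · rw [hval, Subtype.range_coe]; exact hcl

variable (p A) in
theorem exists_liftsPBasis : ∃ (Λ : Type u) (T : Λ → A), LiftsPBasis p T := by
  obtain ⟨Λ, T, hT, -⟩ := exists_liftsPBasis_of_pIndependent (p := p) (S := (∅ : Set A))
    (Set.injOn_empty _) (by rw [Set.image_empty]; exact pIndependent_empty)
  exact ⟨Λ, T, hT⟩

theorem exists_liftsPBasis_mem {a : A} (ha : ∀ y, y ^ p ≠ residue A a) :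
    ∃ (Λ : Type u) (T : Λ → A) (l : Λ), LiftsPBasis p T ∧ T l = a := by
  obtain ⟨Λ, T, hT, h⟩ := exists_liftsPBasis_of_pIndependent (p := p) (S := {a})
    (Set.injOn_singleton _ _) (by rw [Set.image_singleton]; exact pIndependent_singleton ha)
  obtain ⟨l, hl⟩ := h rfl
  exact ⟨Λ, T, l, hT, hl⟩

theorem LiftsPBasis.isUniversal {Λ : Type u} {T : Λ → A} (hT : LiftsPBasis p T) {ϖ : A}
    (hϖ : Irreducible ϖ) :
    IsUniversalResidualPerfection p A (Completion A (Model p ϖ T)) where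
  isCompleteResidualPerfection := hT.isCompleteResidualPerfection hϖ
  initial _ _ _ hB := existsUnique_algHom_completion_model hϖ T hB

end Existence

/-! ### The generic residual perfection by localization and completion. -/

section Generic

open IsLocalRing

variable {p : ℕ} [Fact p.Prime] {A : Type u} [CommRing A] [IsDomain A] [IsDiscreteValuationRing A]
  [CharP (ResidueField A) p] {B : Type u} [CommRing B] [Algebra A B]

/-- The localization at the prime ideal generated by the maximal ideal of `A`. -/
abbrev ReductionLocalization (A : Type u) [CommRing A] [IsLocalRing A] (B : Type u) [CommRing B]
    [Algebra A B] [(maxIdeal A B).IsPrime] :=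
  Localization.AtPrime (maxIdeal A B)

variable [(maxIdeal A B).IsPrime]

theorem maxIdeal_reductionLocalization :
    maxIdeal A (ReductionLocalization A B) = maximalIdeal (ReductionLocalization A B) := by
  rw [← Localization.AtPrime.map_eq_maximalIdeal]
  unfold maxIdeal
  rw [Ideal.map_map, ← IsScalarTower.algebraMap_eq]

/-- The canonical map to the localization. -/
noncomputable def toReductionLocalization : B →ₐ[A] ReductionLocalization A B :=
  (Algebra.ofId B (ReductionLocalization A B)).restrictScalars A

theorem reductionLocalization_mem_iff {b : B} :
    toReductionLocalization (A := A) b ∈ maxIdeal A (ReductionLocalization A B) ↔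
      b ∈ maxIdeal A B := by
  rw [maxIdeal_reductionLocalization]
  exact IsLocalization.AtPrime.to_map_mem_maximal_iff _ (maxIdeal A B) b

theorem isUnit_reductionMap {x : Reduction A B} (hx : x ≠ 0) :
    IsUnit (reductionMap (toReductionLocalization (A := A) (B := B)) x) := by
  obtain ⟨b, rfl⟩ := Ideal.Quotient.mk_surjective x
  rw [Ne, Ideal.Quotient.eq_zero_iff_mem] at hx
  rw [reductionMap_mk]
  exact (IsLocalization.map_units (ReductionLocalization A B)
    (⟨b, hx⟩ : (maxIdeal A B).primeCompl)).map _

theorem exists_mul_reductionMap_eq (z : Reduction A (ReductionLocalization A B)) :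
    ∃ x y : Reduction A B, y ≠ 0 ∧
      z * reductionMap (toReductionLocalization (A := A) (B := B)) y =
        reductionMap (toReductionLocalization (A := A) (B := B)) x := by
  obtain ⟨z, rfl⟩ := Ideal.Quotient.mk_surjective z
  obtain ⟨⟨b, s⟩, hs⟩ := IsLocalization.surj (maxIdeal A B).primeCompl z
  refine ⟨Ideal.Quotient.mk _ b, Ideal.Quotient.mk _ s.1, ?_, ?_⟩
  · rw [Ne, Ideal.Quotient.eq_zero_iff_mem]
    exact s.2
  · rw [reductionMap_mk, reductionMap_mk, ← map_mul]
    exact congr_arg _ hs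

variable (A B) in
theorem reductionMap_toReductionLocalization_injective :
    Function.Injective (reductionMap (toReductionLocalization (A := A) (B := B))) := by
  rw [injective_iff_map_eq_zero]
  intro x hx
  obtain ⟨b, rfl⟩ := Ideal.Quotient.mk_surjective x
  rw [reductionMap_mk, Ideal.Quotient.eq_zero_iff_mem, reductionLocalization_mem_iff] at hx
  rwa [Ideal.Quotient.eq_zero_iff_mem]

theorem isDomain_reduction_localization : IsDomain (Reduction A (ReductionLocalization A B)) := by
  rw [Ideal.Quotient.isDomain_iff_prime, maxIdeal_reductionLocalization]
  infer_instance

/-- Numerator and denominator of a fraction both have `p`-th roots. -/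
theorem perfect_reductionLocalization (h : Function.Bijective fun x : Reduction A B => x ^ p) :
    Function.Bijective fun x : Reduction A (ReductionLocalization A B) => x ^ p := by
  have := isDomain_reduction_localization (A := A) (B := B)
  have := charP_reduction (p := p) (A := A) (C := ReductionLocalization A B)
  have : ExpChar (Reduction A (ReductionLocalization A B)) p := .prime Fact.out
  refine ⟨frobenius_inj _ p, fun z => ?_⟩
  obtain ⟨x, y, hy, hxy⟩ := exists_mul_reductionMap_eq z
  obtain ⟨x', rfl⟩ := h.2 x
  obtain ⟨y', rfl⟩ := h.2 y
  have hy' : y' ≠ 0 := by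
    rintro rfl
    exact hy (zero_pow (Fact.out : p.Prime).ne_zero)
  obtain ⟨u, hu⟩ := isUnit_reductionMap hy'
  refine ⟨reductionMap (toReductionLocalization (A := A) (B := B)) x' * ↑u⁻¹, ?_⟩
  change _ ^ p = z
  simp only [map_pow, ← hu] at hxy
  rw [mul_pow, ← hxy, mul_assoc, ← mul_pow, Units.mul_inv, one_pow, mul_one]

/-- A complete residual perfection with integral reduction has a generic residual perfection. -/
theorem isGenericResidualPerfection_completion (hB : IsCompleteResidualPerfection p A B) :
    IsGenericResidualPerfection p A B (Completion A (ReductionLocalization A B)) where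
  isCompleteResidualPerfection := by
    have := hB.flat
    have : Module.Flat A (ReductionLocalization A B) := Module.Flat.trans A B _
    exact isCompleteResidualPerfection_completion (perfect_reductionLocalization hB.perfect)
  isFractionRing := by
    let f : B →ₐ[A] Completion A (ReductionLocalization A B) :=
      (toCompletion A _).comp toReductionLocalization
    have hf : ∀ x, reductionMap f x = reductionMap (toCompletion A (ReductionLocalization A B))
        (reductionMap (toReductionLocalization (A := A)) x) := by
      intro x
      obtain ⟨b, rfl⟩ := Ideal.Quotient.mk_surjective x
      rfl
    have hbij := reductionMap_toCompletion_bijective A (ReductionLocalization A B)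
    refine ⟨f, ?_⟩
    let _ : Algebra (Reduction A B) (Reduction A (Completion A (ReductionLocalization A B))) :=
      (reductionMap f).toAlgebra
    have halg : ∀ x, algebraMap (Reduction A B) (Reduction A (Completion A _)) x =
      reductionMap (toCompletion A (ReductionLocalization A B))
        (reductionMap (toReductionLocalization (A := A)) x) := hf
    have : IsDomain (Reduction A B) := (Ideal.Quotient.isDomain_iff_prime _).2 inferInstance
    refine (isLocalization_iff _ _).2 ⟨?_, ?_, ?_⟩
    · intro y
      rw [halg]
      refine (isUnit_reductionMap ?_).map _
      exact nonZeroDivisors.coe_ne_zero y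
    · intro z
      obtain ⟨z, rfl⟩ := hbij.2 z
      obtain ⟨x, y, hy, hxy⟩ := exists_mul_reductionMap_eq z
      refine ⟨(x, ⟨y, mem_nonZeroDivisors_of_ne_zero hy⟩), ?_⟩
      rw [halg, halg, ← hxy, map_mul]
    · intro x y hxy
      rw [halg, halg] at hxy
      exact ⟨1, by rw [(reductionMap_toReductionLocalization_injective A B) (hbij.1 hxy)]⟩

theorem exists_universal_generic (p : ℕ) [Fact p.Prime] (A : Type u) [CommRing A] [IsDomain A]
    [IsDiscreteValuationRing A] [CharP (ResidueField A) p] :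
    ∃ (Au : Type u) (_ : CommRing Au) (_ : Algebra A Au)
      (Ag : Type u) (_ : CommRing Ag) (_ : Algebra A Ag),
      IsUniversalResidualPerfection p A Au ∧ IsGenericResidualPerfection p A Au Ag := by
  obtain ⟨ϖ, hϖ⟩ := IsDiscreteValuationRing.exists_irreducible A
  obtain ⟨Λ, T, hT⟩ := exists_liftsPBasis A p
  have := hT.isDomain hϖ
  have : IsDomain (Reduction A (Completion A (Model p ϖ T))) :=
    (RingEquiv.ofBijective _
      (reductionMap_toCompletion_bijective A (Model p ϖ T))).symm.toMulEquiv.isDomain _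
  have : (maxIdeal A (Completion A (Model p ϖ T))).IsPrime :=
    (Ideal.Quotient.isDomain_iff_prime _).1 this
  exact ⟨_, _, _, _, _, _, hT.isUniversal hϖ,
    isGenericResidualPerfection_completion (hT.isCompleteResidualPerfection hϖ)⟩

end Generic

/-! ### Elements algebraic over `k` in the fraction field of the perfection. -/

section RootRingAlgebraic

variable {Λ : Type*} {k : Type*} [Field k] {p : ℕ} [Fact p.Prime] [CharP k p] {t : Λ → k}
  {L : Type*} [CommRing L] [IsDomain L] [Algebra k L]

/-- If `L` is a ring of fractions of a root ring over a polynomial ring over `k`, then an element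
of `L` that is algebraic over `k` is purely inseparable over `k`. -/
theorem exists_pow_eq_algebraMap (ψ : RootRing p (residueFamily t) →+* L)
    (hψ : Function.Injective ψ)
    (hC : ∀ c, ψ (algebraMap (MvPolynomial (Λ × ℕ) k) _ (MvPolynomial.C c)) = algebraMap k L c)
    (hfrac : ∀ z, ∃ x y, y ≠ 0 ∧ z * ψ y = ψ x) {z : L} (hz : IsAlgebraic k z) :
    ∃ n c, z ^ p ^ n = algebraMap k L c := by
  let R := MvPolynomial (Λ × ℕ) k
  let j : R →ₐ[k] L := { ψ.comp (algebraMap R _) with commutes' := hC }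
  have hj : Function.Injective j := hψ.comp RootRing.algebraMap_injective
  obtain ⟨x, y, hy, hxy⟩ := hfrac z
  obtain ⟨m, f, hf⟩ := RootRing.exists_pow_mem_range x
  obtain ⟨n, g, hg⟩ := RootRing.exists_pow_mem_range y
  have hjf : j f = ψ x ^ p ^ m := by rw [← map_pow, hf]; rfl
  have hjg : j g = ψ y ^ p ^ n := by rw [← map_pow, hg]; rfl
  have hg0 : j (g ^ p ^ m) ≠ 0 := by
    rw [map_pow, hjg]
    exact pow_ne_zero _ (pow_ne_zero _ ((map_ne_zero_iff ψ hψ).2 hy))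
  -- A `p`-power power of `z` is a fraction of polynomials. Being integral over `k`, it is a
  -- polynomial because `k[X]` is integrally closed; if nonzero it is then a unit, hence constant.
  have hz1 : z ^ p ^ (m + n) * j (g ^ p ^ m) = j (f ^ p ^ n) := by
    rw [map_pow, map_pow, hjf, hjg, ← hxy, ← pow_mul, ← pow_mul, ← pow_add, ← pow_add, mul_pow,
      add_comm n m]
  have hj' : Function.Injective ((Algebra.algHom k L (FractionRing L)).comp j) :=
    (IsFractionRing.injective L (FractionRing L)).comp hj
  let e : FractionRing R →ₐ[k] FractionRing L := IsFractionRing.liftAlgHom hj'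
  let w : FractionRing R := algebraMap R _ (f ^ p ^ n) / algebraMap R _ (g ^ p ^ m)
  have he : ∀ r : R, e (algebraMap R _ r) = algebraMap L _ (j r) := fun r =>
    IsFractionRing.lift_algebraMap hj' r
  have hew : e w = algebraMap L (FractionRing L) (z ^ p ^ (m + n)) := by
    rw [map_div₀, he, he, div_eq_iff, ← map_mul, hz1]
    rwa [Ne, IsFractionRing.to_map_eq_zero_iff]
  have hw : IsIntegral k w := by
    rw [← isIntegral_algHom_iff e e.injective, hew]
    exact (hz.isIntegral.pow _).algebraMap
  obtain ⟨r, hr⟩ := IsIntegrallyClosed.isIntegral_iff.1 (hw.tower_top (A := R))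
  have hzr : z ^ p ^ (m + n) = j r := by
    refine IsFractionRing.injective L (FractionRing L) ?_
    rw [← hew, ← hr, he]
  have hrint : IsIntegral k r := by
    rwa [← isIntegral_algebraMap_iff (IsFractionRing.injective R (FractionRing R)), hr]
  refine ⟨m + n, ?_⟩
  by_cases hr0 : r = 0
  · exact ⟨0, by rw [hzr, hr0, map_zero, map_zero]⟩
  · obtain ⟨c, -, hc⟩ := MvPolynomial.isUnit_iff_eq_C_of_isReduced.1 (hrint.isUnit hr0)
    exact ⟨c, by rw [hzr, hc]; exact hC c⟩

end RootRingAlgebraic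

/-! ### Complete flat algebras whose reduction is a field. -/

section FieldReduction

open IsLocalRing

variable {A : Type*} [CommRing A] [IsDomain A] [IsDiscreteValuationRing A] {ϖ : A}
  {B : Type*} [CommRing B] [Algebra A B]

/-- By completeness the ideal lies in the Jacobson radical, so invertibility lifts from the
reduction. -/
theorem isUnit_of_notMem_maxIdeal [IsAdicComplete (maxIdeal A B) B]
    (hF : IsField (Reduction A B)) {b : B} (hb : b ∉ maxIdeal A B) : IsUnit b := by
  obtain ⟨c, hc⟩ := hF.mul_inv_cancel (a := Ideal.Quotient.mk (maxIdeal A B) b)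
    (by rwa [Ne, Ideal.Quotient.eq_zero_iff_mem])
  obtain ⟨c, rfl⟩ := Ideal.Quotient.mk_surjective c
  rw [← map_mul, ← map_one (Ideal.Quotient.mk _), Ideal.Quotient.eq] at hc
  have := Ideal.mem_jacobson_bot.1 (IsAdicComplete.le_jacobson_bot _ hc) 1
  rw [mul_one, sub_add_cancel] at this
  exact isUnit_of_mul_isUnit_left this

theorem exists_eq_pow_mul_isUnit (hϖ : Irreducible ϖ) [IsAdicComplete (maxIdeal A B) B]
    (hF : IsField (Reduction A B)) {b : B} (hb : b ≠ 0) :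
    ∃ n u, IsUnit u ∧ b = algebraMap A B ϖ ^ n * u := by
  classical
  have h : ∃ n, ¬ algebraMap A B ϖ ^ n ∣ b := by
    by_contra! h
    exact hb (eq_zero_of_forall_pow_dvd hϖ h)
  obtain ⟨m, hm⟩ := Nat.exists_eq_succ_of_ne_zero (n := Nat.find h) fun h0 => by
    have := Nat.find_spec h
    rw [h0, pow_zero] at this
    exact this (one_dvd b)
  have hdvd : algebraMap A B ϖ ^ m ∣ b := not_not.1 (Nat.find_min h (by omega))
  obtain ⟨u, rfl⟩ := hdvd
  refine ⟨m, u, isUnit_of_notMem_maxIdeal hF fun hu => ?_, rfl⟩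
  have hspec := Nat.find_spec h
  rw [hm, pow_succ] at hspec
  exact hspec (mul_dvd_mul_left _ ((mem_maxIdeal hϖ).1 hu))

theorem isDomain_of_isField_reduction (hϖ : Irreducible ϖ) [Module.Flat A B]
    [IsAdicComplete (maxIdeal A B) B] (hF : IsField (Reduction A B)) : IsDomain B := by
  have hreg : algebraMap A B ϖ ∈ nonZeroDivisors B := by
    rw [mem_nonZeroDivisors_iff_left]
    exact (flat_iff hϖ).1 inferInstance
  have : Nontrivial (Reduction A B) := hF.nontrivial
  have : Nontrivial B := (Ideal.Quotient.mk_surjective (I := maxIdeal A B)).nontrivial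
  have : ∀ b : B, b ≠ 0 → b ∈ nonZeroDivisors B := by
    intro b hb
    obtain ⟨n, u, hu, rfl⟩ := exists_eq_pow_mul_isUnit hϖ hF hb
    exact mul_mem (pow_mem hreg n) hu.mem_nonZeroDivisors
  have : NoZeroDivisors B := ⟨fun {a b} hab => by
    by_contra! h
    exact h.2 ((mem_nonZeroDivisors_iff_left.1 (this a h.1)) b hab)⟩
  exact NoZeroDivisors.to_isDomain B

instance algebraResidueFieldReduction : Algebra (ResidueField A) (Reduction A B) :=
  inferInstanceAs (Algebra (A ⧸ maximalIdeal A) (Reduction A B))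

theorem algebraMap_residue (a : A) :
    algebraMap (ResidueField A) (Reduction A B) (residue A a) =
      Ideal.Quotient.mk _ (algebraMap A B a) := rfl

/-- Dividing an annihilating polynomial by the largest possible power of `ϖ`, which is regular in
`B`, keeps its reduction nonzero. -/
theorem isAlgebraic_mk (hϖ : Irreducible ϖ) [Module.Flat A B] {b : B} (hb : IsAlgebraic A b) :
    IsAlgebraic (ResidueField A) (Ideal.Quotient.mk (maxIdeal A B) b) := by
  obtain ⟨q, hq0, hq⟩ := hb
  have hnu : ¬ IsUnit (Polynomial.C ϖ) := by
    rw [Polynomial.isUnit_C]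
    exact hϖ.not_isUnit
  obtain ⟨q', hq', hndvd⟩ :=
    (FiniteMultiplicity.of_not_isUnit hnu hq0).exists_eq_pow_mul_and_not_dvd
  have hreg : algebraMap A B ϖ ∈ nonZeroDivisors B := by
    rw [mem_nonZeroDivisors_iff_left]
    exact (flat_iff hϖ).1 inferInstance
  rw [hq', map_mul, map_pow, Polynomial.aeval_C] at hq
  have hq1 := mem_nonZeroDivisors_iff_left.1 (pow_mem hreg _) _ hq
  refine ⟨q'.map (residue A), fun h0 => hndvd ?_, ?_⟩
  · rw [Polynomial.C_dvd_iff_dvd_coeff]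
    intro i
    have := congr_arg (Polynomial.coeff · i) h0
    simp only [Polynomial.coeff_map, Polynomial.coeff_zero] at this
    rwa [residue_eq_zero_iff, hϖ.maximalIdeal_eq, Ideal.mem_span_singleton] at this
  · have h2 := congr_arg (Ideal.Quotient.mk (maxIdeal A B)) hq1
    rw [map_zero, Polynomial.aeval_def, Polynomial.hom_eval₂] at h2
    rw [Polynomial.aeval_def, Polynomial.eval₂_map]
    exact h2

end FieldReduction

/-! ### Comparing arbitrary universal and generic perfections with the model. -/

section GenericModel

open IsLocalRing

variable {p : ℕ} [Fact p.Prime] {A : Type u} [CommRing A] [IsDomain A] [IsDiscreteValuationRing A]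
  [CharP (ResidueField A) p] {ϖ : A} {Au Ag : Type u} [CommRing Au] [Algebra A Au]
  [CommRing Ag] [Algebra A Ag]

omit [Fact p.Prime] [IsDomain A] [IsDiscreteValuationRing A] [CharP (ResidueField A) p] in
theorem IsUniversalResidualPerfection.exists_bijective [IsLocalRing A]
    (h : IsUniversalResidualPerfection p A Au) (h' : IsUniversalResidualPerfection p A Ag) :
    ∃ g : Au →ₐ[A] Ag, Function.Bijective (reductionMap g) := by
  obtain ⟨⟨g⟩, -⟩ := h.initial Ag h'.isCompleteResidualPerfection
  obtain ⟨⟨g'⟩, -⟩ := h'.initial Au h.isCompleteResidualPerfection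
  obtain ⟨u⟩ := h.initial Au h.isCompleteResidualPerfection
  obtain ⟨u'⟩ := h'.initial Ag h'.isCompleteResidualPerfection
  have h1 : g'.comp g = AlgHom.id A Au := Subsingleton.elim _ _
  have h2 : g.comp g' = AlgHom.id A Ag := Subsingleton.elim _ _
  refine ⟨g, Function.bijective_iff_has_inverse.2 ⟨reductionMap g', fun x => ?_, fun x => ?_⟩⟩
  · obtain ⟨x, rfl⟩ := Ideal.Quotient.mk_surjective x
    exact congr_arg (Ideal.Quotient.mk _) (DFunLike.congr_fun h1 x)
  · obtain ⟨x, rfl⟩ := Ideal.Quotient.mk_surjective x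
    exact congr_arg (Ideal.Quotient.mk _) (DFunLike.congr_fun h2 x)

/-- Since `T` is arbitrary, the `p`-basis can be adapted to the element under study while `Au` stays
fixed. -/
theorem LiftsPBasis.exists_algHom_bijective {Λ : Type u} {T : Λ → A} (hT : LiftsPBasis p T)
    (hϖ : Irreducible ϖ) (hAu : IsUniversalResidualPerfection p A Au) :
    ∃ g : Model p ϖ T →ₐ[A] Au, Function.Bijective (reductionMap g) := by
  obtain ⟨g, hg⟩ := (hT.isUniversal hϖ).exists_bijective hAu
  refine ⟨g.comp (toCompletion A _), ?_⟩
  have : ⇑(reductionMap (g.comp (toCompletion A (Model p ϖ T)))) =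
      reductionMap g ∘ reductionMap (toCompletion A (Model p ϖ T)) := by
    funext x
    obtain ⟨x, rfl⟩ := Ideal.Quotient.mk_surjective x
    rfl
  rw [this]
  exact hg.comp (reductionMap_toCompletion_bijective A _)

theorem IsUniversalResidualPerfection.isDomain_reduction
    (hAu : IsUniversalResidualPerfection p A Au) : IsDomain (Reduction A Au) := by
  obtain ⟨ϖ, hϖ⟩ := IsDiscreteValuationRing.exists_irreducible A
  obtain ⟨Λ, T, hT⟩ := exists_liftsPBasis A p
  obtain ⟨g, hg⟩ := hT.exists_algHom_bijective hϖ hAu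
  have := hT.isDomain hϖ
  exact (RingEquiv.ofBijective _ hg).symm.toMulEquiv.isDomain _

theorem IsGenericResidualPerfection.isField_reduction
    (hAu : IsUniversalResidualPerfection p A Au) (hAg : IsGenericResidualPerfection p A Au Ag) :
    IsField (Reduction A Ag) := by
  obtain ⟨f, hf⟩ := hAg.isFractionRing
  have := hAu.isDomain_reduction
  let _ : Algebra (Reduction A Au) (Reduction A Ag) := (reductionMap f).toAlgebra
  exact @Field.toIsField _ (IsFractionRing.toField (Reduction A Au))

/-- The reduction of a generic residual perfection is the field of fractions of the reduction
of the model. -/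
theorem IsGenericResidualPerfection.exists_model_fraction
    (hAu : IsUniversalResidualPerfection p A Au) (hAg : IsGenericResidualPerfection p A Au Ag)
    {Λ : Type u} {T : Λ → A} (hT : LiftsPBasis p T) (hϖ : Irreducible ϖ) :
    ∃ (h : Model p ϖ T →ₐ[A] Ag)
      (ψ : RootRing p (residueFamily fun l => residue A (T l)) →+* Reduction A Ag),
      Function.Injective ψ ∧
      (∀ f, ψ (algebraMap _ _ (MvPolynomial.map (residue A) f)) =
        Ideal.Quotient.mk _ (h (modelOf p ϖ T f))) ∧
      ∀ z, ∃ x y, y ≠ 0 ∧ z * ψ y = ψ x := by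
  obtain ⟨g, hg⟩ := hT.exists_algHom_bijective hϖ hAu
  obtain ⟨f, hf⟩ := hAg.isFractionRing
  obtain ⟨e, he⟩ := exists_reductionEquiv (p := p) T hϖ
  have := hAu.isDomain_reduction
  let _ : Algebra (Reduction A Au) (Reduction A Ag) := (reductionMap f).toAlgebra
  let E : Reduction A Au ≃+* RootRing p (residueFamily fun l => residue A (T l)) :=
    (RingEquiv.ofBijective _ hg).symm.trans e
  have hE : ∀ x, E.symm x = reductionMap g (e.symm x) := fun x => rfl
  refine ⟨f.comp g, (reductionMap f).comp E.symm, ?_, fun q => ?_, fun z => ?_⟩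
  · exact (IsFractionRing.injective (Reduction A Au) (Reduction A Ag)).comp E.symm.injective
  · rw [← he, RingHom.comp_apply, RingHom.coe_coe, hE, e.symm_apply_apply]
    rfl
  · obtain ⟨⟨x, s⟩, hs⟩ := IsLocalization.surj (nonZeroDivisors (Reduction A Au)) z
    refine ⟨E x, E s, ?_, ?_⟩
    · rw [Ne, E.map_eq_zero_iff]
      exact nonZeroDivisors.coe_ne_zero s
    · simp only [RingHom.comp_apply, RingHom.coe_coe, E.symm_apply_apply]
      exact hs

end GenericModel

/-! ### Algebraic elements of the generic residual perfection. -/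

section Algebraic

open IsLocalRing

variable {p : ℕ} [Fact p.Prime] {A : Type u} [CommRing A] [IsDomain A] [IsDiscreteValuationRing A]
  [CharP (ResidueField A) p] {ϖ : A} {Au Ag : Type u} [CommRing Au] [Algebra A Au]
  [CommRing Ag] [Algebra A Ag]

theorem IsGenericResidualPerfection.exists_pow_mk_eq
    (hAu : IsUniversalResidualPerfection p A Au) (hAg : IsGenericResidualPerfection p A Au Ag)
    {z : Reduction A Ag} (hz : IsAlgebraic (ResidueField A) z) :
    ∃ (n : ℕ) (a : A), z ^ p ^ n = Ideal.Quotient.mk _ (algebraMap A Ag a) := by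
  obtain ⟨ϖ, hϖ⟩ := IsDiscreteValuationRing.exists_irreducible A
  obtain ⟨Λ, T, hT⟩ := exists_liftsPBasis A p
  obtain ⟨h, ψ, hψ, hψf, hfrac⟩ := hAg.exists_model_fraction hAu hT hϖ
  have := (hAg.isField_reduction hAu).isDomain
  obtain ⟨n, c, hc⟩ := exists_pow_eq_algebraMap ψ hψ (fun c => by
    obtain ⟨a, rfl⟩ := residue_surjective c
    rw [← MvPolynomial.map_C, hψf, ← algebraMap_model, AlgHom.commutes, algebraMap_residue])
    hfrac hz
  obtain ⟨a, rfl⟩ := residue_surjective c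
  exact ⟨n, a, hc⟩

/-- If the residue of `a` is not a `p`-th power, then the second digit of a `p`-th power
congruent to `a` is transcendental. -/
theorem IsGenericResidualPerfection.not_isAlgebraic_digit
    (hAu : IsUniversalResidualPerfection p A Au) (hAg : IsGenericResidualPerfection p A Au Ag)
    (hϖ : Irreducible ϖ) {a : A} (ha : ∀ y, y ^ p ≠ residue A a) {α c : Ag}
    (hα : α ^ p = algebraMap A Ag a + algebraMap A Ag ϖ * c) :
    ¬ IsAlgebraic (ResidueField A) (Ideal.Quotient.mk (maxIdeal A Ag) c) := by
  -- The `p`-basis is chosen so that `a` is one of the lifts `T l`.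
  obtain ⟨Λ, T, l, hT, rfl⟩ := exists_liftsPBasis_mem ha
  obtain ⟨h, ψ, hψ, hψf, -⟩ := hAg.exists_model_fraction hAu hT hϖ
  have hC := hAg.isCompleteResidualPerfection
  have hflat := (flat_iff hϖ).1 hC.flat
  have hϖmk : Ideal.Quotient.mk (maxIdeal A Ag) (algebraMap A Ag ϖ) = 0 :=
    (mk_eq_zero_iff hϖ).2 dvd_rfl
  set X := h (modelOf p ϖ T (MvPolynomial.X (l, 0))) with hX
  set σ := h (modelRoot p ϖ T (.inl l) 1) with hσ
  have hσp : σ ^ p = algebraMap A Ag (T l) - algebraMap A Ag ϖ * X := by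
    rw [hσ, ← map_pow, modelRoot_succ_pow, modelRoot_inl_zero, map_sub, map_mul, AlgHom.commutes,
      AlgHom.commutes]
  have hmk : Ideal.Quotient.mk (maxIdeal A Ag) α = Ideal.Quotient.mk _ σ := by
    refine hC.perfect.1 ?_
    change _ ^ p = _ ^ p
    rw [← map_pow, ← map_pow, hα, hσp, map_add, map_sub, map_mul, map_mul, hϖmk, zero_mul,
      zero_mul, add_zero, sub_zero]
  -- As `α` and `σ` are congruent, their `p`-th powers agree modulo `ϖ ^ 2`; comparing the
  -- coefficients of `ϖ` gives `c ≡ -X`.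
  have hsq : α ^ p ≡ σ ^ p [SMOD maxIdeal A Ag ^ 2] := by
    have := (SModEq.sub_mem.2 (Ideal.Quotient.eq.1 hmk)).pow_pow_add_one
      (natCast_mem_maxIdeal (p := p) (A := A)) (m := 1)
    rwa [pow_one] at this
  have hdvd : algebraMap A Ag ϖ ∣ c - -X := by
    have h1 := (mem_maxIdeal_pow hϖ).1 (SModEq.sub_mem.1 hsq)
    obtain ⟨d, hd⟩ := h1
    refine ⟨d, sub_eq_zero.1 (hflat _ ?_)⟩
    linear_combination hd - hα + hσp
  have hcX : Ideal.Quotient.mk (maxIdeal A Ag) c = -Ideal.Quotient.mk _ X := by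
    rw [← map_neg]
    exact (mk_eq_mk_iff hϖ).2 hdvd
  rw [hcX]
  intro halg
  let j : MvPolynomial (Λ × ℕ) (ResidueField A) →ₐ[ResidueField A] Reduction A Ag :=
    { ψ.comp (algebraMap _ _) with
      commutes' := fun c => by
        obtain ⟨a, rfl⟩ := residue_surjective c
        change ψ (algebraMap _ _ (MvPolynomial.C _)) = _
        rw [← MvPolynomial.map_C, hψf, ← algebraMap_model, AlgHom.commutes, algebraMap_residue] }
  have hj : Function.Injective j := hψ.comp RootRing.algebraMap_injective
  have hjX : j (MvPolynomial.X (l, 0)) = Ideal.Quotient.mk _ X := by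
    rw [hX, ← hψf, MvPolynomial.map_X]
    rfl
  have h1 := halg.neg
  rw [neg_neg, ← hjX, isAlgebraic_algHom_iff j hj] at h1
  exact MvPolynomial.transcendental_X _ _ h1

theorem IsGenericResidualPerfection.isDomain
    (hAu : IsUniversalResidualPerfection p A Au) (hAg : IsGenericResidualPerfection p A Au Ag) :
    IsDomain Ag := by
  obtain ⟨ϖ, hϖ⟩ := IsDiscreteValuationRing.exists_irreducible A
  have := hAg.isCompleteResidualPerfection.flat
  have := hAg.isCompleteResidualPerfection.complete
  exact isDomain_of_isField_reduction hϖ (hAg.isField_reduction hAu)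

theorem IsGenericResidualPerfection.algebraMap_injective
    (hAu : IsUniversalResidualPerfection p A Au) (hAg : IsGenericResidualPerfection p A Au Ag) :
    Function.Injective (algebraMap A Ag) := by
  have := hAg.isCompleteResidualPerfection.flat
  have := hAg.isDomain hAu
  exact FaithfulSMul.algebraMap_injective A Ag

/-- If `b` is algebraic over `A` and congruent to `a`, then so is the quotient of the difference
by the uniformizer. -/
theorem exists_isAlgebraic_sub_eq [IsDomain Ag] (hinj : Function.Injective (algebraMap A Ag))
    (hϖ : Irreducible ϖ) {b : Ag} (hb : IsAlgebraic A b) {a : A}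
    (h : Ideal.Quotient.mk (maxIdeal A Ag) b = Ideal.Quotient.mk _ (algebraMap A Ag a)) :
    ∃ c, IsAlgebraic A c ∧ b - algebraMap A Ag a = algebraMap A Ag ϖ * c := by
  obtain ⟨c, hc⟩ := (mk_eq_mk_iff hϖ).1 h
  refine ⟨c, ?_, hc⟩
  refine IsAlgebraic.of_mul (mem_nonZeroDivisors_of_ne_zero ?_) (isAlgebraic_algebraMap ϖ)
    (hc ▸ hb.sub (isAlgebraic_algebraMap a))
  exact (map_ne_zero_iff _ hinj).2 hϖ.ne_zero

/-- If the residue of `a` is a `p`-th power, injectivity of Frobenius lowers `n`. Otherwise `b ^ p ^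
n` is a `p`-th root of `a + ϖ * c` with `c` algebraic, contradicting the transcendence of that
digit. -/
theorem IsGenericResidualPerfection.exists_mk_eq_of_pow
    (hAu : IsUniversalResidualPerfection p A Au) (hAg : IsGenericResidualPerfection p A Au Ag)
    {b : Ag} (hb : IsAlgebraic A b) {n : ℕ} {a : A}
    (h : Ideal.Quotient.mk (maxIdeal A Ag) b ^ p ^ n = Ideal.Quotient.mk _ (algebraMap A Ag a)) :
    ∃ a, Ideal.Quotient.mk (maxIdeal A Ag) b = Ideal.Quotient.mk _ (algebraMap A Ag a) := by
  obtain ⟨ϖ, hϖ⟩ := IsDiscreteValuationRing.exists_irreducible A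
  have := hAg.isDomain hAu
  have hC := hAg.isCompleteResidualPerfection
  have := hC.flat
  induction n generalizing a with
  | zero => exact ⟨a, by rwa [pow_zero, pow_one] at h⟩
  | succ n ih =>
    rw [pow_succ, pow_mul] at h
    by_cases ha : ∃ y, y ^ p = residue A a
    · obtain ⟨y, hy⟩ := ha
      obtain ⟨y, rfl⟩ := residue_surjective y
      refine ih (a := y) (hC.perfect.1 ?_)
      change _ ^ p = _ ^ p
      rw [h, ← algebraMap_residue, ← algebraMap_residue, ← hy, map_pow]
    · push Not at ha
      rw [← map_pow, ← map_pow] at h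
      obtain ⟨c, hc, hbc⟩ := exists_isAlgebraic_sub_eq (hAg.algebraMap_injective hAu) hϖ
        ((hb.pow _).pow p) h
      exact (hAg.not_isAlgebraic_digit hAu hϖ ha (sub_eq_iff_eq_add'.1 hbc)
        (isAlgebraic_mk hϖ hc)).elim

/-- Elements of a generic residual perfection that are algebraic over a complete `A` lie
in `A`. -/
theorem IsGenericResidualPerfection.mem_range_of_isAlgebraic
    [IsAdicComplete (maximalIdeal A) A]
    (hAu : IsUniversalResidualPerfection p A Au) (hAg : IsGenericResidualPerfection p A Au Ag)
    {b : Ag} (hb : IsAlgebraic A b) : ∃ a, algebraMap A Ag a = b := by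
  obtain ⟨ϖ, hϖ⟩ := IsDiscreteValuationRing.exists_irreducible A
  have := hAg.isDomain hAu
  have hinj := hAg.algebraMap_injective hAu
  have hC := hAg.isCompleteResidualPerfection
  have := hC.flat
  have := hC.complete
  let O := Subalgebra.algebraicClosure A Ag
  have hhaus : IsHausdorff (maxIdeal A O) O := ⟨fun x hx => by
    refine Subtype.ext (IsHausdorff.haus' (I := maxIdeal A Ag) _ fun n => ?_)
    have := hx n
    rw [SModEq.zero, smul_eq_mul, Ideal.mul_top] at this ⊢
    exact map_mem_maxIdeal_pow O.val this⟩
  have hsurj : Function.Surjective (algebraMap A O) := by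
    -- As `A` is complete and `O` separated, surjectivity onto the reduction of `O` suffices.
    refine surjective_of_mk_map_comp_surjective (I := maximalIdeal A) (algebraMap A O) fun x => ?_
    obtain ⟨x, rfl⟩ := Ideal.Quotient.mk_surjective x
    obtain ⟨n, a, hna⟩ := hAg.exists_pow_mk_eq hAu (isAlgebraic_mk hϖ x.2)
    obtain ⟨a, ha⟩ := hAg.exists_mk_eq_of_pow hAu x.2 hna
    -- The quotient `c` is again algebraic, so the divisibility by `ϖ` holds within `O` and not only
    -- in `Ag`.
    obtain ⟨c, hc, hxc⟩ := exists_isAlgebraic_sub_eq hinj hϖ x.2 ha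
    refine ⟨a, Eq.symm ((mk_eq_mk_iff (A := A) hϖ).2 ⟨⟨c, hc⟩, Subtype.ext hxc⟩)⟩
  obtain ⟨a, ha⟩ := hsurj ⟨b, hb⟩
  exact ⟨a, congr_arg Subtype.val ha⟩

/-- Every denominator is a power of `ϖ` times a unit; multiplying by that power of `ϖ` preserves
algebraicity and reduces to an element of `Ag`. -/
theorem IsGenericResidualPerfection.algebraicClosure_eq_bot
    [IsAdicComplete (maximalIdeal A) A]
    (hAu : IsUniversalResidualPerfection p A Au) (hAg : IsGenericResidualPerfection p A Au Ag)
    (K : Type v) [Field K] [Algebra A K] [IsFractionRing A K]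
    (Kg : Type w) [Field Kg] [Algebra Ag Kg] [IsFractionRing Ag Kg]
    [Algebra A Kg] [IsScalarTower A Ag Kg] [Algebra K Kg] [IsScalarTower A K Kg] :
    algebraicClosure K Kg = ⊥ := by
  obtain ⟨ϖ, hϖ⟩ := IsDiscreteValuationRing.exists_irreducible A
  have := hAg.isDomain hAu
  have := hAg.isCompleteResidualPerfection.complete
  have hinj := hAg.algebraMap_injective hAu
  rw [eq_bot_iff]
  intro x hx
  rw [mem_algebraicClosure_iff, ← IsFractionRing.isAlgebraic_iff A K Kg] at hx
  obtain ⟨u, s, hs, rfl⟩ := IsFractionRing.div_surjective (A := Ag) x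
  obtain ⟨n, v, hv, rfl⟩ := exists_eq_pow_mul_isUnit hϖ (hAg.isField_reduction hAu)
    (nonZeroDivisors.ne_zero hs)
  obtain ⟨v, rfl⟩ := hv
  have hϖ0 : algebraMap A Kg ϖ ≠ 0 := by
    rw [IsScalarTower.algebraMap_apply A K Kg, map_ne_zero_iff _ (algebraMap K Kg).injective,
      Ne, IsFractionRing.to_map_eq_zero_iff]
    exact hϖ.ne_zero
  have hv0 : algebraMap Ag Kg v ≠ 0 := (v.isUnit.map (algebraMap Ag Kg)).ne_zero
  have hvv : algebraMap Ag Kg v * algebraMap Ag Kg (↑v⁻¹ : Ag) = 1 := by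
    rw [← map_mul, Units.mul_inv, map_one]
  have hx' : algebraMap Ag Kg u / algebraMap Ag Kg (algebraMap A Ag ϖ ^ n * v) =
      algebraMap Ag Kg (u * ↑v⁻¹) / algebraMap A Kg ϖ ^ n := by
    rw [map_mul, map_pow, map_mul, ← IsScalarTower.algebraMap_apply, div_eq_div_iff
      (mul_ne_zero (pow_ne_zero _ hϖ0) hv0) (pow_ne_zero _ hϖ0)]
    linear_combination -(algebraMap Ag Kg u) * algebraMap A Kg ϖ ^ n * hvv
  rw [hx'] at hx ⊢
  have hb : IsAlgebraic A (u * ↑v⁻¹ : Ag) := by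
    rw [← isAlgebraic_algebraMap_iff (IsFractionRing.injective Ag Kg)]
    have := hx.mul ((isAlgebraic_algebraMap ϖ).pow n)
    rwa [div_mul_cancel₀ _ (pow_ne_zero _ hϖ0)] at this
  obtain ⟨a, ha⟩ := hAg.mem_range_of_isAlgebraic hAu hb
  rw [← ha, ← IsScalarTower.algebraMap_apply, IsScalarTower.algebraMap_apply A K Kg,
    IsScalarTower.algebraMap_apply A K Kg, ← map_pow, ← map_div₀]
  exact IntermediateField.algebraMap_mem _ _

end Algebraic

end ResidualPerfection

theorem mainTheorem4 (p : ℕ) [Fact p.Prime]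
    (A : Type u) [CommRing A] [IsDomain A] [IsDiscreteValuationRing A]
    [IsAdicComplete (IsLocalRing.maximalIdeal A) A]
    [CharP (IsLocalRing.ResidueField A) p]
    (K : Type v) [Field K] [Algebra A K] [IsFractionRing A K] :
    -- a universal and a generic residual perfection of `A` exist
    (∃ (Au : Type u) (_ : CommRing Au) (_ : Algebra A Au)
       (Ag : Type u) (_ : CommRing Ag) (_ : Algebra A Ag),
      ResidualPerfection.IsUniversalResidualPerfection p A Au ∧
      ResidualPerfection.IsGenericResidualPerfection p A Au Ag) ∧
    -- and for any choice of them, `K` is algebraically closed in the fraction field of `Ag`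
    ∀ (Au : Type u) [CommRing Au] [Algebra A Au] (Ag : Type u) [CommRing Ag] [Algebra A Ag],
      ResidualPerfection.IsUniversalResidualPerfection p A Au →
      ResidualPerfection.IsGenericResidualPerfection p A Au Ag →
      IsDomain (ResidualPerfection.Reduction A Au) ∧
      IsDomain Ag ∧
      Function.Injective (algebraMap A Ag) ∧
      ∀ (Kg : Type w) [Field Kg] [Algebra Ag Kg] [IsFractionRing Ag Kg]
        [Algebra A Kg] [IsScalarTower A Ag Kg] [Algebra K Kg] [IsScalarTower A K Kg],
        algebraicClosure K Kg = ⊥ :=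
  ⟨ResidualPerfection.exists_universal_generic p A, fun _ _ _ _ _ _ hAu hAg =>
    ⟨hAu.isDomain_reduction, hAg.isDomain hAu, hAg.algebraMap_injective hAu,
      fun Kg _ _ _ _ _ _ _ => hAg.algebraicClosure_eq_bot hAu K Kg⟩⟩
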